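/- Let $d\ge 0$ and $N\geq 2$ be integers and let $(S_1,\dots,S_N)$ be maps $S_i\colon\mathbb{R}^d\to\mathbb{R}^d$ with $|S_iu-S_iv|=r_i|u-v|$ for all $u,v$, where $r_i\in(0,1)$. Suppose that the open set condition holds: there is a nonempty open set $U\subseteq\mathbb{R}^d$ such that $\bigcup_i S_iU\subseteq U$ and the sets $S_1U,\dots,S_NU$ are pairwise disjoint. Let $F$ be the attractor (the unique nonempty compact set with $F=\bigcup_i S_iF$), let $s\ge 0$ be the similarity dimension (the unique $s\geq 0$ with $\sum_i r_i^s=1$), let $(p_1,\dots,p_N)$ be a probability vector with all $p_i>0$, and put $t:=\max_{1\le i\le N}\frac{\log p_i}{\log r_i}$. For $v\in F$, $\delta>0$ and a sequence $(i_n)_{n\ge1}$ in $\{1,\dots,N\}$ let $x_0=v$, $x_n=S_{i_n}x_{n-1}$, and let the $\delta$-waiting time $W_{\delta,v}$ be the least $n\ge 1$ such that every point of $F$ lies within distance at most $\delta$ of one of $x_1,\dots,x_n$ ($+\infty$ if there is none). Let $\mathbb{E}(W_{\delta,v})$ be its expectation when the $i_n$ are independent with $\mathbb{P}(i_n=i)=p_i$.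 Then $t\ge s$, with equality if and only if $p_i=r_i^s$ for every $i$. Moreover: (a) If the maximum defining $t$ is attained at a unique index $i$, then there is a constant $C>0$ such that for all $v\in F$ and all $0<\delta<\min_i r_i$, $$C^{-1}\delta^{-t}\log\log\left(\tfrac1\delta\right)\le \mathbb{E}(W_{\delta,v})\le C\,\delta^{-t}\left(\max\left\{1,\log\log\left(\tfrac1\delta\right)\right\}\right)^2 .$$ (If $\min_i r_i<e^{-1}$, then $\log\log(1/\delta)$ is bounded below by a positive constant on this range of $\delta$, so the maximum with $1$ can be dropped after enlarging $C$.) (b) If the maximum is attained at two or more indices, then there is a constant $C>0$ such that for all $v\in F$ and all $0<\delta<\min_i r_i$, $$C^{-1}\delta^{-t}\log\left(\tfrac1\delta\right)\le \mathbb{E}(W_{\delta,v})\le C\,\delta^{-t}\log\left(\tfrac1\delta\right).$$ -/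

import Mathlib

open MeasureTheory

namespace ChaosGame

/-- Each `S i` is a similitude of `ℝ^d` with contraction ratio `r i ∈ (0,1)`. -/
def IsSimilitudeIFS {d N : ℕ}
    (S : Fin N → EuclideanSpace ℝ (Fin d) → EuclideanSpace ℝ (Fin d)) (r : Fin N → ℝ) : Prop :=
  ∀ i, 0 < r i ∧ r i < 1 ∧ ∀ u v, dist (S i u) (S i v) = r i * dist u v

/-- The open set condition. -/
def OpenSetCondition {d N : ℕ}
    (S : Fin N → EuclideanSpace ℝ (Fin d) → EuclideanSpace ℝ (Fin d)) : Prop :=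
  ∃ U : Set (EuclideanSpace ℝ (Fin d)), U.Nonempty ∧ IsOpen U ∧
    (⋃ i, S i '' U) ⊆ U ∧ ∀ i j, i ≠ j → Disjoint (S i '' U) (S j '' U)

/-- `F` is the attractor of `S`: the (unique) nonempty compact set with `F = ⋃ i, S i F`. -/
def IsAttractor {d N : ℕ}
    (S : Fin N → EuclideanSpace ℝ (Fin d) → EuclideanSpace ℝ (Fin d))
    (F : Set (EuclideanSpace ℝ (Fin d))) : Prop :=
  F.Nonempty ∧ IsCompact F ∧ F = ⋃ i, S i '' F

/-- `s` is the similarity dimension: the (unique) `s ≥ 0` with `∑ i, r i ^ s = 1`. -/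
def IsSimilarityDimension {N : ℕ} (r : Fin N → ℝ) (s : ℝ) : Prop :=
  0 ≤ s ∧ ∑ i, r i ^ s = 1

/-- A nondegenerate probability vector. -/
def IsNondegenerateProbVector {N : ℕ} (p : Fin N → ℝ) : Prop :=
  (∀ i, 0 < p i) ∧ ∑ i, p i = 1

/-- The exponent `t = max_i (log p_i / log r_i)`. -/
noncomputable def exponent {N : ℕ} (p r : Fin N → ℝ) : ℝ :=
  ⨆ i, Real.log (p i) / Real.log (r i)

/-- The orbit `x_0 = v`, `x_{n+1} = S_{ω n} x_n`; here `ω n` is the `(n+1)`-st symbol. -/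
def orbit {d N : ℕ}
    (S : Fin N → EuclideanSpace ℝ (Fin d) → EuclideanSpace ℝ (Fin d))
    (v : EuclideanSpace ℝ (Fin d)) (ω : ℕ → Fin N) : ℕ → EuclideanSpace ℝ (Fin d)
  | 0 => v
  | n + 1 => S (ω n) (orbit S v ω n)

/-- `X` is `δ`-dense in `F`. -/
def IsDeltaDense {d : ℕ} (δ : ℝ) (F X : Set (EuclideanSpace ℝ (Fin d))) : Prop :=
  X ⊆ F ∧ ∀ z ∈ F, ∃ x ∈ X, dist x z ≤ δ

/-- The `δ`-waiting time: the least `n ≥ 1` for which `{x_1, …, x_n}` is `δ`-dense in `F`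
(and `⊤` if there is none). -/
noncomputable def waitingTime {d N : ℕ}
    (S : Fin N → EuclideanSpace ℝ (Fin d) → EuclideanSpace ℝ (Fin d))
    (F : Set (EuclideanSpace ℝ (Fin d))) (δ : ℝ) (v : EuclideanSpace ℝ (Fin d))
    (ω : ℕ → Fin N) : ℕ∞ :=
  ⨅ (n : ℕ) (_ : 1 ≤ n ∧ IsDeltaDense δ F (orbit S v ω '' Set.Icc 1 n)), (n : ℕ∞)

/-- The Bernoulli measure on `{1, …, N}^ℕ` with weights `p`: the infinite product of the measure
on `{1, …, N}` giving mass `p i` to `i`. -/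
noncomputable def bernoulliMeasure {N : ℕ} (p : Fin N → ℝ) : Measure (ℕ → Fin N) :=
  Measure.infinitePi fun _ : ℕ => ∑ i, ENNReal.ofReal (p i) • Measure.dirac i

/-- The expected `δ`-waiting time, as an extended nonnegative real. -/
noncomputable def expectedWaitingTime {d N : ℕ}
    (S : Fin N → EuclideanSpace ℝ (Fin d) → EuclideanSpace ℝ (Fin d))
    (F : Set (EuclideanSpace ℝ (Fin d))) (p : Fin N → ℝ) (δ : ℝ)
    (v : EuclideanSpace ℝ (Fin d)) : ENNReal :=
  ∫⁻ ω, (waitingTime S F δ v ω : ENNReal) ∂(bernoulliMeasure p)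

end ChaosGame

/-!
The history of the random orbit at time `n` is read backwards: `x_n ∈ S_I F` whenever the `n`-th
history, i.e. the stream of the drawn letters, most recent one first, followed by a code of `v`,
starts with the word `I`. So the waiting time is the cover time of a family of words, up to constants
in `δ`, and `p_I ≥ r_I ^ t` with equality exactly for the words in the letters at which the maximum
`t` is attained.

*Upper bounds.* The orbit is `δ`-dense once all words cut at the scale `δ / (diam F + 1)` have
occurred. A word `I` may overlap itself, but an overlap in all but `s` letters has conditional
probability at most `(max p) ^ s`; hence one occurrence entails only a bounded number of further ones
in expectation, and the waiting time for `I` has an exponential tail at the scale `1 / p_I` with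
constants independent of `I` (`measureReal_unseen_le`). Cut words have `p_I ≳ δ ^ t` and length
`L = O(log (1 / δ))`, so that the union bound gives `δ ^ (-t) log (1 / δ)`. If the maximum is attained
at a single letter `i₀`, a cut word with `k` letters other than `i₀` even has `p_I ≳ (k + 1) δ ^ t`.
The resulting union bound `∑ y ^ (k + 1)` with `y = exp (-c n δ ^ t)` factors over the letters and is
small as soon as `L y` is, which gives `δ ^ (-t) log L`. This is better than the claimed bound.

*Lower bounds.* Following Schief, a word `K` with the largest possible number of neighbours (a bounded
quantity by the open set condition and a packing argument) has the property that points of `F` within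
distance `r_{IK}` of `S_{IK} F` have all their codes starting with `I` (`exists_separating_word`).
Thus `δ`-density forces every word `I` with `r_I r_K ≥ δ` to occur. For a family `A` of such words,
of equal length and equal probability `P`, Matthews' argument bounds the expected cover time below by
a constant multiple of `P⁻¹ log |A|`: the word of `A` occurring last is each `I` with probabilities
adding up to `1`, and costs an additional time of order `1 / P`
(`ofReal_harmonic_le_tsum_uncovered`). This needs that, when one word of `A` has just occurred, no
other one is about to occur, which holds if all of them start with a marker `i ⋯ i j` (`i ≠ j`). If the
maximum is attained at two letters `i, j`, the words composed of `k ≍ log (1 / δ)` blocks `i j` or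
`j i` form a family of `2 ^ k` words with `P = R ^ t`, where `R ≍ δ`. If it is attained at `i`, the
words with one letter `j` among `k` letters `i` form a family of `k + 1` words with `P ≍ R ^ t`.
-/

open scoped ENNReal

namespace ChaosGame

/-! ### Words, histories and independence of the past -/

/-- The stream `ξ` starts with the word `I`. -/
def Begins {ι : Type*} : List ι → (ℕ → ι) → Prop
  | [], _ => True
  | i :: I, ξ => ξ 0 = i ∧ Begins I fun k => ξ (k + 1)

/-- The stream `ω (n-1), …, ω 0, η 0, η 1, …`: the first `n` letters of `ω`, most recent letter
first, followed by an initial stream `η`. If `η` is a code of the starting point `v`, this is a code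
of the `n`-th point of the orbit of `v`. -/
def history {ι : Type*} (η ω : ℕ → ι) : ℕ → ℕ → ι
  | 0 => η
  | n + 1 => fun k => Nat.casesOn k (ω n) (history η ω n)

/-- The product of the weights `p i` along the word `I`. -/
def wordProd {ι : Type*} (p : ι → ℝ) (I : List ι) : ℝ := (I.map p).prod

@[simp] lemma wordProd_nil {ι : Type*} (p : ι → ℝ) : wordProd p [] = 1 := rfl

@[simp] lemma wordProd_cons {ι : Type*} (p : ι → ℝ) (i : ι) (I : List ι) :
    wordProd p (i :: I) = p i * wordProd p I := by
  simp [wordProd]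

lemma wordProd_append {ι : Type*} (p : ι → ℝ) (I J : List ι) :
    wordProd p (I ++ J) = wordProd p I * wordProd p J := by
  simp [wordProd]

lemma wordProd_pos {ι : Type*} {p : ι → ℝ} (hp : ∀ i, 0 < p i) (I : List ι) :
    0 < wordProd p I := by
  induction I with
  | nil => simp
  | cons i I ih => simpa using mul_pos (hp i) ih

lemma wordProd_le_pow {ι : Type*} {p : ι → ℝ} {q : ℝ} (hp : ∀ i, 0 < p i) (hq : ∀ i, p i ≤ q)
    (I : List ι) : wordProd p I ≤ q ^ I.length := by
  induction I with
  | nil => simp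
  | cons i I ih =>
    rw [wordProd_cons, List.length_cons, pow_succ']
    exact mul_le_mul (hq i) ih (wordProd_pos hp I).le ((hp i).le.trans (hq i))

lemma begins_history_succ {ι : Type*} (η ω : ℕ → ι) (n : ℕ) (i : ι) (I : List ι) :
    Begins (i :: I) (history η ω (n + 1)) ↔ ω n = i ∧ Begins I (history η ω n) := Iff.rfl

lemma Begins.eq_of_length_eq {ι : Type*} {I J : List ι} {ξ : ℕ → ι} (hI : Begins I ξ)
    (hJ : Begins J ξ) (h : I.length = J.length) : I = J := by
  induction I generalizing J ξ with
  | nil => exact (List.length_eq_zero_iff.mp (by simpa using h.symm)).symm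
  | cons i I ih =>
    cases J with
    | nil => simp at h
    | cons j J =>
      rw [← hI.1, ← hJ.1, ih hI.2 hJ.2 (by simpa using h)]

lemma Begins.of_prefix {ι : Type*} {I J : List ι} {ξ : ℕ → ι} (hJ : Begins J ξ) (h : I <+: J) :
    Begins I ξ := by
  induction I generalizing J ξ with
  | nil => trivial
  | cons i I ih =>
    cases J with
    | nil => simp at h
    | cons j J =>
      obtain ⟨rfl, h'⟩ := List.cons_prefix_cons.mp h
      exact ⟨hJ.1, ih hJ.2 h'⟩

/-- The event `B` depends on the first `n` letters only. -/
def IsPast {ι : Type*} (n : ℕ) (B : Set (ℕ → ι)) : Prop :=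
  ∀ ω ω' : ℕ → ι, (∀ k < n, ω k = ω' k) → ω ∈ B → ω' ∈ B

lemma IsPast.mono {ι : Type*} {n m : ℕ} {B : Set (ℕ → ι)} (hB : IsPast n B) (h : n ≤ m) :
    IsPast m B := fun ω ω' hω => hB ω ω' fun k hk => hω k (hk.trans_le h)

lemma IsPast.inter {ι : Type*} {n : ℕ} {B B' : Set (ℕ → ι)} (hB : IsPast n B)
    (hB' : IsPast n B') : IsPast n (B ∩ B') :=
  fun ω ω' hω h => ⟨hB ω ω' hω h.1, hB' ω ω' hω h.2⟩

lemma IsPast.compl {ι : Type*} {n : ℕ} {B : Set (ℕ → ι)} (hB : IsPast n B) : IsPast n Bᶜ :=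
  fun ω ω' hω h h' => h (hB ω' ω (fun k hk => (hω k hk).symm) h')

lemma history_congr {ι : Type*} {η ω ω' : ℕ → ι} {n : ℕ} (h : ∀ k < n, ω k = ω' k) :
    history η ω n = history η ω' n := by
  induction n with
  | zero => rfl
  | succ n ih =>
    rw [history, history, ih fun k hk => h k (hk.trans n.lt_succ_self), h n n.lt_succ_self]

lemma isPast_of_history {ι : Type*} (η : ℕ → ι) (n : ℕ) (Q : (ℕ → ℕ → ι) → Prop)
    (hQ : ∀ g g' : ℕ → ℕ → ι, (∀ k ≤ n, g k = g' k) → Q g → Q g') :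
    IsPast n {ω | Q (history η ω)} := fun _ _ h hω =>
  hQ _ _ (fun _ hk => history_congr fun j hj => h j (hj.trans_le hk)) hω

lemma isPast_begins {ι : Type*} (η : ℕ → ι) (I : List ι) {k n : ℕ} (hk : k ≤ n) :
    IsPast n {ω | Begins I (history η ω k)} :=
  isPast_of_history η n (fun g => Begins I (g k)) fun g g' h hg => by rwa [← h k hk]

variable {N d : ℕ}

lemma IsPast.eq_preimage {n : ℕ} {B : Set (ℕ → Fin N)} (hB : IsPast n B) :
    B = (fun (ω : ℕ → Fin N) (k : Finset.range n) => ω k) ⁻¹'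
      ((fun (ω : ℕ → Fin N) (k : Finset.range n) => ω k) '' B) := by
  refine Set.Subset.antisymm (Set.subset_preimage_image _ _) ?_
  rintro ω ⟨ω', hω', h⟩
  exact hB ω' ω (fun k hk => congrFun h ⟨k, Finset.mem_range.mpr hk⟩) hω'

lemma IsPast.measurableSet {n : ℕ} {B : Set (ℕ → Fin N)} (hB : IsPast n B) :
    MeasurableSet B := by
  rw [hB.eq_preimage]
  exact (by fun_prop : Measurable fun (ω : ℕ → Fin N) (k : Finset.range n) => ω k)
    (Set.toFinite _).measurableSet

lemma isProbabilityMeasure_letter {p : Fin N → ℝ} (hp : IsNondegenerateProbVector p) :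
    IsProbabilityMeasure (∑ i, ENNReal.ofReal (p i) • Measure.dirac i : Measure (Fin N)) := by
  constructor
  simp only [Measure.coe_finsetSum, Measure.coe_smul, Finset.sum_apply, Pi.smul_apply,
    measure_univ, smul_eq_mul, mul_one]
  rw [← ENNReal.ofReal_sum_of_nonneg fun i _ => (hp.1 i).le, hp.2, ENNReal.ofReal_one]

lemma isProbabilityMeasure_bernoulli {p : Fin N → ℝ} (hp : IsNondegenerateProbVector p) :
    IsProbabilityMeasure (bernoulliMeasure p) := by
  have := isProbabilityMeasure_letter hp
  unfold bernoulliMeasure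
  infer_instance

/-- The letter `ω n` is independent of the first `n` letters. -/
lemma measureReal_inter_letter {p : Fin N → ℝ} (hp : IsNondegenerateProbVector p) {n : ℕ}
    {B : Set (ℕ → Fin N)} (hB : IsPast n B) (i : Fin N) :
    (bernoulliMeasure p).real (B ∩ {ω | ω n = i}) = (bernoulliMeasure p).real B * p i := by
  have := isProbabilityMeasure_letter hp
  have hi : ProbabilityTheory.iIndepFun (fun (k : ℕ) (ω : ℕ → Fin N) => ω k)
      (bernoulliMeasure p) :=
    ProbabilityTheory.iIndepFun_infinitePi (X := fun _ x => x) fun _ => measurable_id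
  have h := (hi.indepFun_finset (Finset.range n) {n} (by simp) fun k => by fun_prop)
  have hm := h.measure_inter_preimage_eq_mul
    ((fun (ω : ℕ → Fin N) (k : Finset.range n) => ω k) '' B) {g | g ⟨n, by simp⟩ = i}
    (Set.toFinite _).measurableSet (Set.toFinite _).measurableSet
  rw [← hB.eq_preimage] at hm
  have hl : bernoulliMeasure p {ω | ω n = i} = ENNReal.ofReal (p i) := by
    have h2 := Measure.infinitePi_map_eval
      (fun _ : ℕ => (∑ i, ENNReal.ofReal (p i) • Measure.dirac i : Measure (Fin N))) n
    have h3 := congrArg (fun ν => ν {i}) h2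
    rw [Measure.map_apply (by fun_prop) (measurableSet_singleton i)] at h3
    refine h3.trans ?_
    simp only [Measure.coe_finsetSum, Measure.coe_smul, Finset.sum_apply, Pi.smul_apply,
      smul_eq_mul]
    rw [Finset.sum_eq_single i]
    · simp
    · intro j _ hj
      simp [hj]
    · simp
  have he : (fun (ω : ℕ → Fin N) (k : ({n} : Finset ℕ)) => ω k) ⁻¹' {g | g ⟨n, by simp⟩ = i}
      = {ω | ω n = i} := rfl
  rw [he, hl] at hm
  rw [measureReal_def, hm, ENNReal.toReal_mul, ENNReal.toReal_ofReal (hp.1 i).le]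
  rfl

lemma inter_begins_succ (η : ℕ → Fin N) (B : Set (ℕ → Fin N)) (n : ℕ) (i : Fin N)
    (I : List (Fin N)) :
    B ∩ {ω | Begins (i :: I) (history η ω (n + 1))} =
      (B ∩ {ω | Begins I (history η ω n)}) ∩ {ω | ω n = i} := by
  ext ω
  simp only [Set.mem_inter_iff, Set.mem_ofPred_eq, begins_history_succ]
  tauto

/-- Once as many new letters have been drawn as `I` has, the occurrence of `I` is independent of the
past. -/
lemma measureReal_inter_begins_eq {p : Fin N → ℝ} (hp : IsNondegenerateProbVector p)
    (η : ℕ → Fin N) {n : ℕ} {B : Set (ℕ → Fin N)} (hB : IsPast n B) (s : ℕ)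
    (I : List (Fin N)) (hs : I.length ≤ s) :
    (bernoulliMeasure p).real (B ∩ {ω | Begins I (history η ω (n + s))}) =
      (bernoulliMeasure p).real B * wordProd p I := by
  induction I generalizing s with
  | nil => simp [Begins]
  | cons i I ih =>
    obtain ⟨s, rfl⟩ : ∃ s', s = s' + 1 := ⟨s - 1, by simp at hs; omega⟩
    rw [← add_assoc, inter_begins_succ, measureReal_inter_letter hp
      ((hB.mono (by omega)).inter (isPast_begins η I le_rfl)), ih s (by simpa using hs),
      wordProd_cons]
    ring

/-- An occurrence of `I` that overlaps the past in all but `s` letters still has conditional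
probability at most `q ^ s`. -/
lemma measureReal_inter_begins_le_pow {p : Fin N → ℝ} (hp : IsNondegenerateProbVector p) {q : ℝ}
    (hq : ∀ i, p i ≤ q) (η : ℕ → Fin N) {n : ℕ} {B : Set (ℕ → Fin N)} (hB : IsPast n B) (s : ℕ)
    (I : List (Fin N)) (hs : s ≤ I.length) :
    (bernoulliMeasure p).real (B ∩ {ω | Begins I (history η ω (n + s))}) ≤
      (bernoulliMeasure p).real B * q ^ s := by
  have := isProbabilityMeasure_bernoulli hp
  induction s generalizing I with
  | zero => simpa using measureReal_mono Set.inter_subset_left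
  | succ s ih =>
    cases I with
    | nil => simp at hs
    | cons i I =>
      rw [← add_assoc, inter_begins_succ, measureReal_inter_letter hp
        ((hB.mono (by omega)).inter (isPast_begins η I le_rfl)), pow_succ, ← mul_assoc]
      have h := ih I (by simpa using hs)
      exact mul_le_mul h (hq i) (hp.1 i).le (measureReal_nonneg.trans h)

lemma measureReal_inter_begins_le {p : Fin N → ℝ} (hp : IsNondegenerateProbVector p) {q : ℝ}
    (hq : ∀ i, p i ≤ q) (hq0 : 0 ≤ q) (η : ℕ → Fin N) {n : ℕ} {B : Set (ℕ → Fin N)}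
    (hB : IsPast n B) (s : ℕ) (I : List (Fin N)) :
    (bernoulliMeasure p).real (B ∩ {ω | Begins I (history η ω (n + s))}) ≤
      (bernoulliMeasure p).real B * (q ^ s + wordProd p I) := by
  rcases le_total s I.length with h | h
  · refine (measureReal_inter_begins_le_pow hp hq η hB s I h).trans ?_
    exact mul_le_mul_of_nonneg_left (le_add_of_nonneg_right (wordProd_pos hp.1 I).le)
      measureReal_nonneg
  · rw [measureReal_inter_begins_eq hp η hB s I h]
    exact mul_le_mul_of_nonneg_left (le_add_of_nonneg_left (by positivity)) measureReal_nonneg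

/-! ### The waiting time for a single word -/

lemma geom_sum_le_inv_one_sub {q : ℝ} (hq0 : 0 ≤ q) (hq1 : q < 1) (n : ℕ) :
    ∑ i ∈ Finset.range n, q ^ i ≤ (1 - q)⁻¹ := by
  have := geom_sum_Ico_le_of_lt_one (m := 0) (n := n) hq0 hq1
  rwa [pow_zero, one_div, ← Finset.range_eq_Ico] at this

/-- The word `I` does not occur in the history at any of the times `1, …, n`. -/
def unseen (η : ℕ → Fin N) (I : List (Fin N)) (n : ℕ) : Set (ℕ → Fin N) :=
  {ω | ∀ k, 1 ≤ k → k ≤ n → ¬ Begins I (history η ω k)}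

lemma isPast_unseen (η : ℕ → Fin N) (I : List (Fin N)) {n m : ℕ} (h : n ≤ m) :
    IsPast m (unseen η I n) :=
  isPast_of_history η m (fun g => ∀ k, 1 ≤ k → k ≤ n → ¬ Begins I (g k)) fun g g' hg H k h1 hk => by
    rw [← hg k (hk.trans h)]
    exact H k h1 hk

lemma unseen_antitone (η : ℕ → Fin N) (I : List (Fin N)) {n m : ℕ} (h : n ≤ m) :
    unseen η I m ⊆ unseen η I n := fun _ hω k h1 hk => hω k h1 (hk.trans h)

/-- The time `a + j` is the first one after `a` at which `I` occurs. -/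
def firstSeen (η : ℕ → Fin N) (I : List (Fin N)) (a j : ℕ) : Set (ℕ → Fin N) :=
  {ω | Begins I (history η ω (a + j)) ∧ ∀ i < j, ¬ Begins I (history η ω (a + i))}

lemma isPast_firstSeen (η : ℕ → Fin N) (I : List (Fin N)) (a j : ℕ) :
    IsPast (a + j) (firstSeen η I a j) :=
  isPast_of_history η _ (fun g => Begins I (g (a + j)) ∧ ∀ i < j, ¬ Begins I (g (a + i)))
    fun g g' hg H => ⟨by rw [← hg _ le_rfl]; exact H.1, fun i hi => by
      rw [← hg _ (by omega)]
      exact H.2 i hi⟩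

lemma exists_firstSeen {η ω : ℕ → Fin N} {I : List (Fin N)} {a k : ℕ}
    (h : Begins I (history η ω (a + k))) : ∃ j ≤ k, ω ∈ firstSeen η I a j := by
  classical
  have hex : ∃ j, Begins I (history η ω (a + j)) := ⟨k, h⟩
  exact ⟨Nat.find hex, Nat.find_min' hex h, Nat.find_spec hex, fun i hi => Nat.find_min hex hi⟩

lemma pairwiseDisjoint_firstSeen (η : ℕ → Fin N) (I : List (Fin N)) (a : ℕ) {j j' : ℕ}
    (h : j ≠ j') : Disjoint (firstSeen η I a j) (firstSeen η I a j') := by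
  rw [Set.disjoint_left]
  intro ω h1 h2
  rcases lt_or_gt_of_ne h with h | h
  · exact h2.2 _ h h1.1
  · exact h1.2 _ h h2.1

/-- First-occurrence decomposition: among `τ` consecutive times, lying at least `I.length` after
`n`, the expected number of occurrences of `I` on `B` is `τ p_I P(B)`. On the other hand, after the
first occurrence at most `(1 - q)⁻¹ + τ p_I` occurrences are expected, overlaps included. -/
lemma mul_measureReal_le_measureReal_seen {p : Fin N → ℝ} (hp : IsNondegenerateProbVector p) {q : ℝ}
    (hq : ∀ i, p i ≤ q) (hq0 : 0 ≤ q) (hq1 : q < 1) (η : ℕ → Fin N) {n a : ℕ}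
    {B : Set (ℕ → Fin N)} (hB : IsPast n B) (I : List (Fin N)) (ha : n + I.length ≤ a) (τ : ℕ) :
    τ * wordProd p I * (bernoulliMeasure p).real B ≤
      (bernoulliMeasure p).real (B ∩ ⋃ j ∈ Finset.range τ, firstSeen η I a j) *
        ((1 - q)⁻¹ + τ * wordProd p I) := by
  have := isProbabilityMeasure_bernoulli hp
  set μ := bernoulliMeasure p
  set w := wordProd p I
  have hw : 0 < w := wordProd_pos hp.1 I
  have hB' : ∀ j, IsPast (a + j) B := fun j => hB.mono (by omega)
  have h1 : ∀ k, μ.real (B ∩ {ω | Begins I (history η ω (a + k))}) = μ.real B * w := fun k => by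
    have := measureReal_inter_begins_eq hp η hB (a + k - n) I (by omega)
    rwa [show n + (a + k - n) = a + k by omega] at this
  have h2 : ∀ k ∈ Finset.range τ, μ.real (B ∩ {ω | Begins I (history η ω (a + k))}) ≤
      ∑ j ∈ Finset.range τ, if j ≤ k then μ.real (B ∩ firstSeen η I a j) * (q ^ (k - j) + w)
        else 0 := by
    intro k hk
    rw [← Finset.sum_filter]
    refine (measureReal_mono (s₂ := ⋃ j ∈ (Finset.range τ).filter (· ≤ k),
      (B ∩ firstSeen η I a j) ∩ {ω | Begins I (history η ω (a + k))}) ?_ (measure_ne_top _ _)).trans ?_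
    · rintro ω ⟨hω, hk'⟩
      obtain ⟨j, hj, hj'⟩ := exists_firstSeen hk'
      simp only [Set.mem_iUnion]
      refine ⟨j, ?_, ⟨hω, hj'⟩, hk'⟩
      simp only [Finset.mem_filter, Finset.mem_range] at hk ⊢
      omega
    · refine (measureReal_biUnion_finset_le _ _).trans (Finset.sum_le_sum fun j hj => ?_)
      have hjk : j ≤ k := (Finset.mem_filter.mp hj).2
      have := measureReal_inter_begins_le hp hq hq0 η
        ((hB' j).inter (isPast_firstSeen η I a j)) (k - j) I
      rwa [show a + j + (k - j) = a + k by omega] at this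
  have h3 : ∀ j ∈ Finset.range τ, (∑ k ∈ Finset.range τ,
      if j ≤ k then μ.real (B ∩ firstSeen η I a j) * (q ^ (k - j) + w) else 0) ≤
      μ.real (B ∩ firstSeen η I a j) * ((1 - q)⁻¹ + τ * w) := by
    intro j hj
    have hf : (Finset.range τ).filter (j ≤ ·) = Finset.Ico j τ := by
      ext k
      simp [and_comm]
    rw [← Finset.sum_filter, ← Finset.mul_sum, hf, Finset.sum_Ico_eq_sum_range]
    refine mul_le_mul_of_nonneg_left ?_ measureReal_nonneg
    simp only [add_tsub_cancel_left]
    rw [Finset.sum_add_distrib, Finset.sum_const, Finset.card_range, nsmul_eq_mul]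
    refine add_le_add (geom_sum_le_inv_one_sub hq0 hq1 _)
      (mul_le_mul_of_nonneg_right ?_ hw.le)
    exact_mod_cast Nat.sub_le _ _
  have h4 : ∑ j ∈ Finset.range τ, μ.real (B ∩ firstSeen η I a j) =
      μ.real (B ∩ ⋃ j ∈ Finset.range τ, firstSeen η I a j) := by
    rw [Set.inter_iUnion₂, measureReal_biUnion_finset]
    · exact fun i _ j _ hij => ((pairwiseDisjoint_firstSeen η I a hij).mono
        Set.inter_subset_right Set.inter_subset_right)
    · exact fun j _ => ((hB' j).inter (isPast_firstSeen η I a j)).measurableSet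
  calc τ * w * μ.real B = ∑ k ∈ Finset.range τ,
        μ.real (B ∩ {ω | Begins I (history η ω (a + k))}) := by
        simp_rw [h1]
        rw [Finset.sum_const, Finset.card_range, nsmul_eq_mul]
        ring
    _ ≤ _ := Finset.sum_le_sum h2
    _ ≤ ∑ j ∈ Finset.range τ, μ.real (B ∩ firstSeen η I a j) * ((1 - q)⁻¹ + τ * w) := by
        rw [Finset.sum_comm]
        exact Finset.sum_le_sum h3
    _ = _ := by rw [← Finset.sum_mul, h4]

/-- In any time window of length `≥ 3 / ((1 - q) p_I)` the conditional probability of not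
encountering `I` is at most `1 / 2`. -/
lemma measureReal_unseen_add_le {p : Fin N → ℝ} (hp : IsNondegenerateProbVector p) {q : ℝ}
    (hq : ∀ i, p i ≤ q) (hq0 : 0 ≤ q) (hq1 : q < 1) (η : ℕ → Fin N) (I : List (Fin N)) (n m : ℕ)
    (hm : 3 * ((1 - q)⁻¹ / wordProd p I) ≤ m) :
    (bernoulliMeasure p).real (unseen η I (n + m)) ≤
      1 / 2 * (bernoulliMeasure p).real (unseen η I n) := by
  have := isProbabilityMeasure_bernoulli hp
  set μ := bernoulliMeasure p
  set w := wordProd p I with hw'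
  set l := I.length with hl
  have hw : 0 < w := wordProd_pos hp.1 I
  have hw1 : w ≤ q ^ l := wordProd_le_pow hp.1 hq I
  have hq' : 1 ≤ (1 - q)⁻¹ := (one_le_inv₀ (by linarith)).mpr (by linarith)
  -- `l * w ≤ l * q ^ l ≤ ∑ q ^ i`, so the word is shorter than a third of the window
  have hlw : l * w ≤ (1 - q)⁻¹ := by
    refine le_trans ?_ (geom_sum_le_inv_one_sub hq0 hq1 l)
    calc (l : ℝ) * w ≤ ∑ i ∈ Finset.range l, q ^ l := by
          rw [Finset.sum_const, Finset.card_range, nsmul_eq_mul]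
          exact mul_le_mul_of_nonneg_left hw1 (Nat.cast_nonneg _)
      _ ≤ _ := Finset.sum_le_sum fun i hi =>
          pow_le_pow_of_le_one hq0 hq1.le (Finset.mem_range.mp hi).le
  have hone : w ≤ (1 - q)⁻¹ := (hw1.trans (pow_le_one₀ hq0 hq1.le)).trans hq'
  set τ := m - l - 1 with hτ
  have hmw : 3 * (1 - q)⁻¹ ≤ m * w := by
    rw [← mul_div_assoc, div_le_iff₀ hw] at hm
    exact hm
  have hlm : l + 1 ≤ m := by
    have : ((l + 1 : ℕ) : ℝ) * w ≤ m * w := by push_cast; linarith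
    exact_mod_cast le_of_mul_le_mul_right this hw
  have hτw : (1 - q)⁻¹ ≤ τ * w := by
    have : (τ : ℝ) = m - l - 1 := by
      rw [hτ, Nat.sub_sub, Nat.cast_sub hlm]
      push_cast
      ring
    rw [this]
    linarith
  have h := mul_measureReal_le_measureReal_seen hp hq hq0 hq1 η
    (isPast_unseen η I (le_refl n)) I (a := n + l + 1) (by omega) τ
  set B := unseen η I n
  set X := ⋃ j ∈ Finset.range τ, firstSeen η I (n + l + 1) j with hX
  have hXm : MeasurableSet X := Finset.measurableSet_biUnion _ fun j _ =>
    (isPast_firstSeen η I _ j).measurableSet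
  have hsplit := measureReal_inter_add_sdiff (μ := μ) (s := B) hXm
  have hsub : μ.real (unseen η I (n + m)) ≤ μ.real (B \ X) := by
    refine measureReal_mono fun ω hω => ⟨unseen_antitone η I (Nat.le_add_right n m) hω, ?_⟩
    simp only [hX, Set.mem_iUnion, not_exists]
    intro j hj hj'
    rw [Finset.mem_range] at hj
    exact hω _ (by omega) (by omega) hj'.1
  have hBX : μ.real B ≤ 2 * μ.real (B ∩ X) := by
    have h0 : 0 ≤ μ.real (B ∩ X) := measureReal_nonneg
    have hpos : 0 < τ * w := lt_of_lt_of_le (by linarith) hτw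
    have : τ * w * μ.real B ≤ τ * w * (2 * μ.real (B ∩ X)) := by
      refine h.trans ?_
      nlinarith
    exact le_of_mul_le_mul_left this hpos
  linarith

/-- The waiting time for the word `I` has an exponential tail at the scale `1 / p_I`. -/
lemma measureReal_unseen_le {p : Fin N → ℝ} (hp : IsNondegenerateProbVector p) {q : ℝ}
    (hq : ∀ i, p i ≤ q) (hq0 : 0 ≤ q) (hq1 : q < 1) (η : ℕ → Fin N) (I : List (Fin N)) (n : ℕ) :
    (bernoulliMeasure p).real (unseen η I n) ≤
      2 * Real.exp (-((1 - q) * Real.log 2 / 4 * wordProd p I * n)) := by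
  have := isProbabilityMeasure_bernoulli hp
  set w := wordProd p I with hw'
  have hw : 0 < w := wordProd_pos hp.1 I
  have hw1 : w ≤ 1 := (wordProd_le_pow hp.1 hq I).trans (pow_le_one₀ hq0 hq1.le)
  have hq' : 0 < 1 - q := by linarith
  set x := (1 - q)⁻¹ / w with hx
  have hx1 : 1 ≤ x := by
    rw [hx, le_div_iff₀ hw]
    have : 1 ≤ (1 - q)⁻¹ := (one_le_inv₀ (by linarith)).mpr (by linarith)
    linarith
  set m := ⌈3 * x⌉₊ with hm
  have hm1 : 3 * x ≤ m := Nat.le_ceil _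
  have hm2 : (m : ℝ) ≤ 4 * x := by
    have := (Nat.ceil_lt_add_one (by linarith : 0 ≤ 3 * x)).le
    linarith
  have hiter : ∀ j : ℕ, (bernoulliMeasure p).real (unseen η I (j * m)) ≤ (1 / 2) ^ j := by
    intro j
    induction j with
    | zero => simp
    | succ j ih =>
      rw [Nat.succ_mul, pow_succ']
      refine (measureReal_unseen_add_le hp hq hq0 hq1 η I _ m hm1).trans ?_
      linarith
  have hmpos : 0 < m := by
    have : (0 : ℝ) < m := by linarith
    exact_mod_cast this
  refine (measureReal_mono (unseen_antitone η I (Nat.div_mul_le_self n m))).trans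
    ((hiter _).trans ?_)
  have hdiv : (n : ℝ) ≤ ((n / m : ℕ) + 1) * (4 * x) := by
    have h1 : n < (n / m + 1) * m := Nat.lt_mul_of_div_lt (Nat.lt_succ_self _) hmpos
    have h2 : (n : ℝ) ≤ ((n / m : ℕ) + 1) * m := by exact_mod_cast h1.le
    exact h2.trans (mul_le_mul_of_nonneg_left hm2 (by positivity))
  have hpow : ((1 : ℝ) / 2) ^ (n / m) = 2 * Real.exp (-(((n / m : ℕ) + 1) * Real.log 2)) := by
    rw [Real.exp_neg, mul_comm _ (Real.log 2), ← Real.rpow_def_of_pos two_pos,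
      Real.rpow_add two_pos, Real.rpow_natCast, Real.rpow_one]
    field_simp
    rw [← mul_pow]
    norm_num
  rw [hpow]
  refine mul_le_mul_of_nonneg_left (Real.exp_le_exp.mpr (neg_le_neg ?_)) two_pos.le
  have hlog : 0 < Real.log 2 := Real.log_pos one_lt_two
  have hcx : (1 - q) * w * x = 1 := by
    rw [hx]
    field_simp
  calc (1 - q) * Real.log 2 / 4 * w * n
      ≤ (1 - q) * Real.log 2 / 4 * w * (((n / m : ℕ) + 1) * (4 * x)) :=
        mul_le_mul_of_nonneg_left hdiv (by positivity)
    _ = ((n / m : ℕ) + 1) * Real.log 2 * ((1 - q) * w * x) := by ring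
    _ = _ := by rw [hcx, mul_one]

/-! ### Matthews' lower bound for the cover time of a family of words -/

lemma history_add (η ω : ℕ → Fin N) (n s k : ℕ) :
    history η ω (n + s) (s + k) = history η ω n k := by
  induction s with
  | zero => simp
  | succ s ih =>
    rw [← ih, show s + 1 + k = (s + k) + 1 by omega]
    rfl

lemma Begins.of_marker {i j : Fin N} {D : ℕ} {ξ : ℕ → Fin N}
    (h : Begins (List.replicate D i ++ [j]) ξ) : (∀ k < D, ξ k = i) ∧ ξ D = j := by
  induction D generalizing ξ with
  | zero => exact ⟨fun k hk => absurd hk (Nat.not_lt_zero k), h.1⟩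
  | succ D ih =>
    obtain ⟨h1, h2⟩ := ih h.2
    refine ⟨fun k hk => ?_, h2⟩
    cases k with
    | zero => exact h.1
    | succ k => exact h1 k (by omega)

/-- The word `i ⋯ i j` with `D` letters `i ≠ j` cannot recur after `s ≤ D` steps. -/
lemma not_begins_marker {i j : Fin N} (hij : i ≠ j) {D n s : ℕ} {η ω : ℕ → Fin N}
    (h : Begins (List.replicate D i ++ [j]) (history η ω n)) (hs1 : 1 ≤ s) (hs : s ≤ D) :
    ¬ Begins (List.replicate D i ++ [j]) (history η ω (n + s)) := by
  intro h'
  have h1 := h'.of_marker.2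
  have h2 := h.of_marker.1 (D - s) (by omega)
  have h3 := history_add η ω n s (D - s)
  rw [show s + (D - s) = D by omega] at h3
  exact hij (by rw [← h1, ← h2, h3])

/-- If the history has just completed the marker word `i ⋯ i j`, then, with conditional probability
at least `1 / 2`, a word `I` starting with this marker does not occur within the next
`1 / (4 p_I)` steps. -/
lemma measureReal_le_inter_unseen {p : Fin N → ℝ} (hp : IsNondegenerateProbVector p) {q : ℝ}
    (hq : ∀ i, p i ≤ q) (hq0 : 0 ≤ q) (hq1 : q < 1) {i j : Fin N} (hij : i ≠ j) {D : ℕ}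
    (hD : q ^ D * (1 - q)⁻¹ ≤ 1 / 4) (η : ℕ → Fin N) {n : ℕ} {B : Set (ℕ → Fin N)}
    (hB : IsPast n B) (hBm : ∀ ω ∈ B, Begins (List.replicate D i ++ [j]) (history η ω n))
    {I : List (Fin N)} (hI : List.replicate D i ++ [j] <+: I) (hBI : B ⊆ unseen η I n)
    {τ : ℕ} (hτ : τ * wordProd p I ≤ 1 / 4) :
    1 / 2 * (bernoulliMeasure p).real B ≤
      (bernoulliMeasure p).real (B ∩ unseen η I (n + τ)) := by
  have := isProbabilityMeasure_bernoulli hp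
  set μ := bernoulliMeasure p
  set w := wordProd p I
  have hw : 0 < w := wordProd_pos hp.1 I
  have hsplit := measureReal_inter_add_sdiff (μ := μ) (s := B)
    (isPast_unseen η I (le_refl (n + τ))).measurableSet
  have hsub : μ.real (B \ unseen η I (n + τ)) ≤ ∑ s ∈ Finset.Ico (D + 1) (τ + 1),
      μ.real (B ∩ {ω | Begins I (history η ω (n + s))}) := by
    refine (measureReal_mono (s₂ := ⋃ s ∈ Finset.Ico (D + 1) (τ + 1),
      (B ∩ {ω | Begins I (history η ω (n + s))})) ?_ (measure_ne_top _ _)).trans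
      (measureReal_biUnion_finset_le _ _)
    rintro ω ⟨hω, hu⟩
    simp only [unseen, Set.mem_ofPred_eq, not_forall, not_not] at hu
    obtain ⟨k, hk1, hk2, hk⟩ := hu
    have hnk : n < k := by
      by_contra hcon
      exact hBI hω k hk1 (by omega) hk
    obtain ⟨s, rfl⟩ : ∃ s, k = n + s := ⟨k - n, by omega⟩
    have hDs : D < s := by
      by_contra hcon
      exact not_begins_marker hij (hBm ω hω) (by omega) (by omega) (hk.of_prefix hI)
    simp only [Set.mem_iUnion]
    exact ⟨s, Finset.mem_Ico.mpr ⟨by omega, by omega⟩, hω, hk⟩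
  have hterm : ∑ s ∈ Finset.Ico (D + 1) (τ + 1),
      μ.real (B ∩ {ω | Begins I (history η ω (n + s))}) ≤ μ.real B * (1 / 2) := by
    refine (Finset.sum_le_sum fun s _ =>
      measureReal_inter_begins_le hp hq hq0 η hB s I).trans ?_
    rw [← Finset.mul_sum]
    refine mul_le_mul_of_nonneg_left ?_ measureReal_nonneg
    rw [Finset.sum_add_distrib]
    have h1 : ∑ s ∈ Finset.Ico (D + 1) (τ + 1), q ^ s ≤ 1 / 4 := by
      refine (geom_sum_Ico_le_of_lt_one hq0 hq1).trans (le_trans ?_ hD)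
      rw [div_eq_mul_inv]
      exact mul_le_mul_of_nonneg_right (pow_le_pow_of_le_one hq0 hq1.le (Nat.le_succ D))
        (inv_nonneg.mpr (by linarith))
    have h2 : ∑ s ∈ Finset.Ico (D + 1) (τ + 1), w ≤ 1 / 4 := by
      rw [Finset.sum_const, Nat.card_Ico, nsmul_eq_mul]
      refine (mul_le_mul_of_nonneg_right ?_ hw.le).trans hτ
      exact_mod_cast (by omega : τ + 1 - (D + 1) ≤ τ)
    linarith
  linarith

/-- Some word of `A` does not occur at any of the times `1, …, n`. -/
def uncovered (η : ℕ → Fin N) (A : Finset (List (Fin N))) (n : ℕ) : Set (ℕ → Fin N) :=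
  {ω | ∃ I ∈ A, ω ∈ unseen η I n}

lemma isPast_uncovered (η : ℕ → Fin N) (A : Finset (List (Fin N))) {n m : ℕ} (h : n ≤ m) :
    IsPast m (uncovered η A n) := fun ω ω' hω ⟨I, hI, hu⟩ =>
  ⟨I, hI, isPast_unseen η I h ω ω' hω hu⟩

lemma uncovered_antitone (η : ℕ → Fin N) (A : Finset (List (Fin N))) {n m : ℕ} (h : n ≤ m) :
    uncovered η A m ⊆ uncovered η A n := fun _ ⟨I, hI, hu⟩ => ⟨I, hI, unseen_antitone η I h hu⟩

lemma uncovered_mono (η : ℕ → Fin N) {A A' : Finset (List (Fin N))} (h : A ⊆ A') (n : ℕ) :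
    uncovered η A n ⊆ uncovered η A' n := fun _ ⟨I, hI, hu⟩ => ⟨I, h hI, hu⟩

lemma uncovered_zero (η : ℕ → Fin N) {A : Finset (List (Fin N))} (h : A.Nonempty)
    (ω : ℕ → Fin N) : ω ∈ uncovered η A 0 := by
  obtain ⟨I, hI⟩ := h
  exact ⟨I, hI, fun k h1 h2 => absurd h1 (by omega)⟩

lemma exists_cover_succ {η ω : ℕ → Fin N} {A : Finset (List (Fin N))} (hA : A.Nonempty) {n : ℕ}
    (h : ω ∉ uncovered η A n) :
    ∃ j, j + 1 ≤ n ∧ ω ∈ uncovered η A j ∧ ω ∉ uncovered η A (j + 1) := by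
  classical
  have hex : ∃ n, ω ∉ uncovered η A n := ⟨n, h⟩
  obtain ⟨j, hj⟩ : ∃ j, Nat.find hex = j + 1 := by
    refine Nat.exists_eq_add_one_of_ne_zero fun h0 => ?_
    have := Nat.find_spec hex
    rw [h0] at this
    exact this (uncovered_zero η hA ω)
  refine ⟨j, hj ▸ Nat.find_min' hex h, ?_, hj ▸ Nat.find_spec hex⟩
  by_contra hcon
  have := Nat.find_min' hex hcon
  omega

lemma exists_begins_of_cover_succ {η ω : ℕ → Fin N} {A : Finset (List (Fin N))} {j : ℕ}
    (h : ω ∈ uncovered η A j) (h' : ω ∉ uncovered η A (j + 1)) :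
    ∃ I ∈ A, ω ∈ unseen η I j ∧ Begins I (history η ω (j + 1)) := by
  obtain ⟨I, hI, hu⟩ := h
  refine ⟨I, hI, hu, ?_⟩
  by_contra hcon
  refine h' ⟨I, hI, fun k h1 h2 => ?_⟩
  rcases Nat.lt_or_ge j k with hk | hk
  · obtain rfl : k = j + 1 := by omega
    exact hcon
  · exact hu k h1 hk

/-- The words of `A` other than `I` have all occurred for the first time at time `j + 1`, and `I`
has not yet occurred. -/
def lastWord (η : ℕ → Fin N) (A : Finset (List (Fin N))) (I : List (Fin N)) (j : ℕ) :
    Set (ℕ → Fin N) :=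
  (uncovered η (A.erase I) j \ uncovered η (A.erase I) (j + 1)) ∩ unseen η I (j + 1)

lemma isPast_lastWord (η : ℕ → Fin N) (A : Finset (List (Fin N))) (I : List (Fin N)) (j : ℕ) :
    IsPast (j + 1) (lastWord η A I j) :=
  ((isPast_uncovered η _ (Nat.le_succ j)).inter (isPast_uncovered η _ le_rfl).compl).inter
    (isPast_unseen η I le_rfl)

lemma lastWord_disjoint (η : ℕ → Fin N) (A : Finset (List (Fin N))) (I : List (Fin N)) {j j' : ℕ}
    (h : j ≠ j') : Disjoint (lastWord η A I j) (lastWord η A I j') := by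
  rw [Set.disjoint_left]
  rintro ω ⟨⟨h1, h2⟩, -⟩ ⟨⟨h3, h4⟩, -⟩
  rcases lt_or_gt_of_ne h with h | h
  · exact h2 (uncovered_antitone η _ h h3)
  · exact h4 (uncovered_antitone η _ h h1)

/-- If the words of `A` have the same length, then no two of them occur at the same time, so that
one of them is the last one to occur. -/
lemma one_le_sum_lastWord {p : Fin N → ℝ} (hp : IsNondegenerateProbVector p) (η : ℕ → Fin N)
    {A : Finset (List (Fin N))} {m : ℕ} (hm : ∀ I ∈ A, I.length = m) (hA : 2 ≤ A.card)
    (hfin : ∑' n, bernoulliMeasure p (uncovered η A n) ≠ ∞) :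
    1 ≤ ∑ I ∈ A, ∑' j, bernoulliMeasure p (lastWord η A I j) := by
  have := isProbabilityMeasure_bernoulli hp
  set μ := bernoulliMeasure p
  have hne : A.Nonempty := Finset.card_pos.mp (by omega)
  have h0 : μ (⋂ n, uncovered η A n) = 0 := by
    have ht := ENNReal.tendsto_atTop_zero_of_tsum_ne_top hfin
    exact le_antisymm (ge_of_tendsto' ht fun n => measure_mono (Set.iInter_subset _ n)) zero_le
  have hmeas : MeasurableSet (⋂ n, uncovered η A n) :=
    MeasurableSet.iInter fun n => (isPast_uncovered η A (le_refl n)).measurableSet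
  have h1 : μ (⋂ n, uncovered η A n)ᶜ = 1 := by
    rw [prob_compl_eq_one_iff hmeas, h0]
  rw [← h1]
  calc μ (⋂ n, uncovered η A n)ᶜ ≤ μ (⋃ I ∈ A, ⋃ j, lastWord η A I j) := by
        refine measure_mono fun ω hω => ?_
        simp only [Set.mem_compl_iff, Set.mem_iInter, not_forall] at hω
        obtain ⟨n, hn⟩ := hω
        obtain ⟨k, -, hk1, hk2⟩ := exists_cover_succ hne hn
        obtain ⟨I, hI, hu, hb⟩ := exists_begins_of_cover_succ hk1 hk2
        have hne' : (A.erase I).Nonempty :=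
          Finset.card_pos.mp (by rw [Finset.card_erase_of_mem hI]; omega)
        have hcov : ω ∉ uncovered η (A.erase I) k := by
          rintro ⟨J, hJ, hJu⟩
          obtain ⟨hJI, hJA⟩ := Finset.mem_erase.mp hJ
          refine hk2 ⟨J, hJA, fun l h1 h2 hl => ?_⟩
          rcases Nat.lt_or_ge k l with hkl | hkl
          · obtain rfl : l = k + 1 := by omega
            exact hJI (hl.eq_of_length_eq hb ((hm J hJA).trans (hm I hI).symm))
          · exact hJu l h1 hkl hl
        obtain ⟨j, hj, hj1, hj2⟩ := exists_cover_succ hne' hcov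
        simp only [Set.mem_iUnion]
        exact ⟨I, hI, j, ⟨hj1, hj2⟩, unseen_antitone η I hj hu⟩
    _ ≤ ∑ I ∈ A, μ (⋃ j, lastWord η A I j) := measure_biUnion_finset_le _ _
    _ ≤ _ := Finset.sum_le_sum fun I _ => measure_iUnion_le _

/-- One step of Matthews' argument: on the event that `I` is the last word of `A` to occur, covering
`A` takes longer than covering `A \ {I}` by at least `τ` with conditional probability `1 / 2`. -/
lemma tsum_uncovered_erase_add_le {p : Fin N → ℝ} (hp : IsNondegenerateProbVector p) {q : ℝ}
    (hq : ∀ i, p i ≤ q) (hq0 : 0 ≤ q) (hq1 : q < 1) {i j : Fin N} (hij : i ≠ j) {D : ℕ}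
    (hD : q ^ D * (1 - q)⁻¹ ≤ 1 / 4) (η : ℕ → Fin N) {A : Finset (List (Fin N))}
    (hA : ∀ I ∈ A, List.replicate D i ++ [j] <+: I) {I : List (Fin N)} (hI : I ∈ A) {τ : ℕ}
    (hτ : τ * wordProd p I ≤ 1 / 4) :
    ∑' n, bernoulliMeasure p (uncovered η (A.erase I) n) +
        ENNReal.ofReal (τ / 2) * ∑' k, bernoulliMeasure p (lastWord η A I k) ≤
      ∑' n, bernoulliMeasure p (uncovered η A n) := by
  have := isProbabilityMeasure_bernoulli hp
  set μ := bernoulliMeasure p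
  set H : ℕ → Set (ℕ → Fin N) := fun k => lastWord η A I k ∩ unseen η I (k + 1 + τ) with hH
  have hHmeas : ∀ k, MeasurableSet (H k) := fun k =>
    (isPast_lastWord η A I k).measurableSet.inter (isPast_unseen η I le_rfl).measurableSet
  have hhalf : ∀ k, ENNReal.ofReal (1 / 2) * μ (lastWord η A I k) ≤ μ (H k) := by
    intro k
    have h := measureReal_le_inter_unseen hp hq hq0 hq1 hij hD η (isPast_lastWord η A I k)
      (fun ω hω => by
        obtain ⟨J, hJ, -, hb⟩ := exists_begins_of_cover_succ hω.1.1 hω.1.2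
        exact hb.of_prefix (hA J (Finset.mem_of_mem_erase hJ)))
      (hA I hI) Set.inter_subset_right hτ
    rw [← ofReal_measureReal (μ := μ) (s := lastWord η A I k),
      ← ofReal_measureReal (μ := μ) (s := H k), ← ENNReal.ofReal_mul (by norm_num)]
    exact ENNReal.ofReal_le_ofReal h
  have hn : ∀ n, μ (uncovered η (A.erase I) n) +
      ∑' k, (if k + 1 ≤ n ∧ n ≤ k + τ then μ (H k) else 0) ≤ μ (uncovered η A n) := by
    intro n
    set X : ℕ → Set (ℕ → Fin N) := fun k => if k + 1 ≤ n ∧ n ≤ k + τ then H k else ∅ with hX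
    have hXsub : ∀ k, X k ⊆ lastWord η A I k := fun k => by
      simp only [hX]
      split_ifs
      · exact Set.inter_subset_left
      · exact Set.empty_subset _
    have hXm : ∀ k, MeasurableSet (X k) := fun k => by
      simp only [hX]
      split_ifs
      · exact hHmeas k
      · exact MeasurableSet.empty
    have hsum : ∑' k, (if k + 1 ≤ n ∧ n ≤ k + τ then μ (H k) else 0) = μ (⋃ k, X k) := by
      rw [measure_iUnion (fun k k' hk => (lastWord_disjoint η A I hk).mono (hXsub k) (hXsub k'))
        hXm]
      refine tsum_congr fun k => ?_
      simp only [hX]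
      split_ifs <;> simp
    rw [hsum, ← measure_union _ (MeasurableSet.iUnion hXm)]
    · refine measure_mono (Set.union_subset (uncovered_mono η (Finset.erase_subset I A) n)
        (Set.iUnion_subset fun k ω hω => ?_))
      simp only [hX] at hω
      split_ifs at hω with hk
      · exact ⟨I, hI, unseen_antitone η I (by omega) hω.2⟩
      · exact absurd hω (Set.notMem_empty ω)
    · refine Set.disjoint_iUnion_right.mpr fun k => Set.disjoint_left.mpr fun ω hu hω => ?_
      simp only [hX] at hω
      split_ifs at hω with hk
      · exact hω.1.1.2 (uncovered_antitone η _ hk.1 hu)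
      · exact absurd hω (Set.notMem_empty ω)
  refine le_trans ?_ (ENNReal.tsum_le_tsum hn)
  rw [ENNReal.tsum_add, ENNReal.tsum_comm]
  refine add_le_add_right ?_ _
  rw [← ENNReal.tsum_mul_left]
  refine ENNReal.tsum_le_tsum fun k => ?_
  calc ENNReal.ofReal (τ / 2) * μ (lastWord η A I k)
      = τ * (ENNReal.ofReal (1 / 2) * μ (lastWord η A I k)) := by
        rw [div_eq_mul_one_div, ENNReal.ofReal_mul (Nat.cast_nonneg _), ENNReal.ofReal_natCast,
          mul_assoc]
    _ ≤ τ * μ (H k) := by gcongr; exact hhalf k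
    _ = ∑ n ∈ Finset.Ico (k + 1) (k + 1 + τ), if k + 1 ≤ n ∧ n ≤ k + τ then μ (H k) else 0 := by
        rw [Finset.sum_congr rfl (g := fun _ => μ (H k)), Finset.sum_const, Nat.card_Ico,
          nsmul_eq_mul, add_tsub_cancel_left]
        intro n hn
        rw [Finset.mem_Ico] at hn
        rw [if_pos ⟨hn.1, by omega⟩]
    _ ≤ _ := ENNReal.sum_le_tsum _

/-- Matthews' lower bound for the cover time of a family of words. -/
lemma ofReal_harmonic_le_tsum_uncovered {p : Fin N → ℝ} (hp : IsNondegenerateProbVector p) {q : ℝ}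
    (hq : ∀ i, p i ≤ q) (hq0 : 0 ≤ q) (hq1 : q < 1) {i j : Fin N} (hij : i ≠ j) {D : ℕ}
    (hD : q ^ D * (1 - q)⁻¹ ≤ 1 / 4) (η : ℕ → Fin N) {m τ : ℕ} {A : Finset (List (Fin N))}
    (hA : ∀ I ∈ A, List.replicate D i ++ [j] <+: I) (hm : ∀ I ∈ A, I.length = m)
    (hτ : ∀ I ∈ A, τ * wordProd p I ≤ 1 / 4) :
    ENNReal.ofReal (τ / 2 * ((harmonic A.card : ℝ) - 1)) ≤
      ∑' n, bernoulliMeasure p (uncovered η A n) := by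
  obtain ⟨n, hn⟩ : ∃ n, A.card = n := ⟨_, rfl⟩
  induction n generalizing A with
  | zero =>
    rw [hn, ENNReal.ofReal_of_nonpos]
    · exact zero_le
    · simp only [harmonic_zero, Rat.cast_zero, zero_sub, mul_neg, mul_one, Left.neg_nonpos_iff]
      positivity
  | succ n ih =>
    rcases Nat.eq_zero_or_pos n with rfl | hn0
    · rw [hn, ENNReal.ofReal_of_nonpos]
      · exact zero_le
      · simp
    · rw [hn]
      by_cases hfin : ∑' n, bernoulliMeasure p (uncovered η A n) = ∞
      · rw [hfin]
        exact le_top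
      set V := ∑' n, bernoulliMeasure p (uncovered η A n) with hV
      have hstep : ∀ I ∈ A, ENNReal.ofReal (τ / 2 * ((harmonic n : ℝ) - 1)) +
          ENNReal.ofReal (τ / 2) * ∑' k, bernoulliMeasure p (lastWord η A I k) ≤ V := by
        intro I hI
        refine le_trans (add_le_add_left ?_ _)
          (tsum_uncovered_erase_add_le hp hq hq0 hq1 hij hD η hA hI (hτ I hI))
        have hc : (A.erase I).card = n := by
          rw [Finset.card_erase_of_mem hI, hn, Nat.add_sub_cancel]
        have := ih (A := A.erase I) (fun J hJ => hA J (Finset.mem_of_mem_erase hJ))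
          (fun J hJ => hm J (Finset.mem_of_mem_erase hJ))
          (fun J hJ => hτ J (Finset.mem_of_mem_erase hJ)) hc
        rwa [hc] at this
      have hlast := one_le_sum_lastWord hp η hm (by omega) hfin
      have hsum := Finset.sum_le_sum hstep
      rw [Finset.sum_add_distrib, Finset.sum_const, Finset.sum_const, hn, ← Finset.mul_sum,
        nsmul_eq_mul, nsmul_eq_mul] at hsum
      have hh : (1 : ℝ) ≤ harmonic n := by
        have : (1 : ℚ) ≤ harmonic n := by
          rw [harmonic, ← Nat.succ_pred_eq_of_pos hn0, Finset.sum_range_succ']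
          simp only [zero_add, Nat.cast_one, inv_one, le_add_iff_nonneg_left]
          exact Finset.sum_nonneg fun i _ => by positivity
        exact_mod_cast this
      have hn1 : (0 : ℝ) < ((n + 1 : ℕ) : ℝ) := by positivity
      have hmul : ((n + 1 : ℕ) : ℝ≥0∞) * ENNReal.ofReal (τ / 2 * ((harmonic (n + 1) : ℝ) - 1)) ≤
          ((n + 1 : ℕ) : ℝ≥0∞) * V := by
        refine le_trans (le_of_eq ?_) ((add_le_add_right
          (le_mul_of_one_le_right zero_le hlast) _).trans hsum)
        rw [← ENNReal.ofReal_natCast, ← ENNReal.ofReal_mul hn1.le, ← ENNReal.ofReal_mul hn1.le,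
          ← ENNReal.ofReal_add (mul_nonneg hn1.le
            (mul_nonneg (by positivity) (by linarith))) (by positivity)]
        congr 1
        rw [harmonic_succ]
        push_cast
        field_simp
        ring
      exact (ENNReal.mul_le_mul_iff_right (by simp) (ENNReal.natCast_ne_top _)).mp hmul

/-! ### Codes, cut words and separation -/

lemma exists_upper_bound_lt_one {f : Fin N → ℝ} (hf : ∀ i, f i < 1) :
    ∃ q : ℝ, 0 < q ∧ q < 1 ∧ ∀ i, f i ≤ q := by
  rcases isEmpty_or_nonempty (Fin N) with h | h
  · exact ⟨1 / 2, by norm_num, by norm_num, fun i => h.elim i⟩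
  · obtain ⟨i, hi⟩ := Finite.exists_max f
    exact ⟨max (f i) (1 / 2), by positivity, max_lt (hf i) (by norm_num),
      fun j => (hi j).trans (le_max_left _ _)⟩

lemma exists_pos_lower_bound {f : Fin N → ℝ} (hf : ∀ i, 0 < f i) :
    ∃ c : ℝ, 0 < c ∧ c ≤ 1 ∧ ∀ i, c ≤ f i := by
  rcases isEmpty_or_nonempty (Fin N) with h | h
  · exact ⟨1, one_pos, le_rfl, fun i => h.elim i⟩
  · obtain ⟨i, hi⟩ := Finite.exists_min f
    exact ⟨min (f i) 1, lt_min (hf i) one_pos, min_le_right _ _,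
      fun j => (min_le_left _ _).trans (hi j)⟩

/-- The composition `S i₁ ∘ ⋯ ∘ S iₘ` along the word `i₁ ⋯ iₘ`. -/
def wordMap {ι X : Type*} (S : ι → X → X) : List ι → X → X
  | [], x => x
  | i :: I, x => S i (wordMap S I x)

lemma wordMap_append {ι X : Type*} (S : ι → X → X) (I J : List ι) (x : X) :
    wordMap S (I ++ J) x = wordMap S I (wordMap S J x) := by
  induction I with
  | nil => rfl
  | cons i I ih => rw [List.cons_append, wordMap, ih, wordMap]

lemma wordMap_mem {ι X : Type*} {S : ι → X → X} {F : Set X} (hF : ∀ i, ∀ x ∈ F, S i x ∈ F)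
    (I : List ι) {x : X} (hx : x ∈ F) : wordMap S I x ∈ F := by
  induction I with
  | nil => exact hx
  | cons i I ih => exact hF i _ ih

lemma dist_wordMap {ι X : Type*} [PseudoMetricSpace X] {S : ι → X → X} {r : ι → ℝ}
    (hS : ∀ i u v, dist (S i u) (S i v) = r i * dist u v) (I : List ι) (u v : X) :
    dist (wordMap S I u) (wordMap S I v) = wordProd r I * dist u v := by
  induction I with
  | nil => simp [wordMap]
  | cons i I ih => rw [wordMap, wordMap, hS, ih, wordProd_cons, mul_assoc]

lemma surjective_of_dist_eq_mul {E : Type*} [NormedAddCommGroup E] [InnerProductSpace ℝ E]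
    [FiniteDimensional ℝ E] {f : E → E} {c : ℝ} (hc : 0 < c)
    (hf : ∀ u v, dist (f u) (f v) = c * dist u v) : Function.Surjective f := by
  have hi : Isometry fun x => c⁻¹ • f x := Isometry.of_dist_eq fun u v => by
    rw [dist_smul₀, hf, Real.norm_of_nonneg (inv_pos.mpr hc).le, inv_mul_cancel_left₀ hc.ne']
  set g := hi.affineIsometryOfStrictConvexSpace with hg
  have hs : Function.Surjective g := by
    have h1 : Function.Surjective g.linearIsometry.toLinearMap :=
      LinearMap.surjective_of_injective g.linearIsometry.injective
    exact (AffineMap.linear_surjective_iff g.toAffineMap).mp h1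
  intro y
  obtain ⟨x, hx⟩ := hs (c⁻¹ • y)
  have hx' : c⁻¹ • f x = c⁻¹ • y := hx
  exact ⟨x, smul_right_injective E (inv_ne_zero hc.ne') hx'⟩

lemma surjective_wordMap {ι X : Type*} {S : ι → X → X} (hS : ∀ i, Function.Surjective (S i))
    (I : List ι) : Function.Surjective (wordMap S I) := by
  induction I with
  | nil => exact fun x => ⟨x, rfl⟩
  | cons i I ih => exact (hS i).comp ih

/-- The stream `ξ` is a code of the point `x` of `F`: each initial word `I` of `ξ` satisfies
`x ∈ S_I F`. -/
def IsCode {ι X : Type*} (S : ι → X → X) (F : Set X) (ξ : ℕ → ι) (x : X) : Prop :=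
  ∀ I, Begins I ξ → x ∈ wordMap S I '' F

lemma exists_isCode {ι X : Type*} {S : ι → X → X} {F : Set X} (hF : F ⊆ ⋃ i, S i '' F) {x : X}
    (hx : x ∈ F) : ∃ ξ, IsCode S F ξ x := by
  have h : ∀ y : F, ∃ a : ι × F, S a.1 a.2 = y := by
    rintro ⟨y, hy⟩
    obtain ⟨i, z, hz, hzy⟩ := Set.mem_iUnion.mp (hF hy)
    exact ⟨(i, ⟨z, hz⟩), hzy⟩
  choose σ hσ using h
  have key : ∀ (I : List ι) (y : F),
      Begins I (fun k => (σ ((fun z => (σ z).2)^[k] y)).1) → (y : X) ∈ wordMap S I '' F := by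
    intro I
    induction I with
    | nil => exact fun y _ => ⟨y, y.2, rfl⟩
    | cons i I ih =>
      rintro y ⟨h1, h2⟩
      obtain ⟨z, hz, hzy⟩ := ih (σ y).2 h2
      refine ⟨z, hz, ?_⟩
      rw [wordMap, hzy, ← hσ y, ← h1]
      rfl
  exact ⟨_, fun I hI => key I ⟨x, hx⟩ hI⟩

lemma isCode_history {S : Fin N → EuclideanSpace ℝ (Fin d) → EuclideanSpace ℝ (Fin d)}
    {F : Set (EuclideanSpace ℝ (Fin d))} (hF : ∀ i, ∀ x ∈ F, S i x ∈ F) {η : ℕ → Fin N}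
    {v : EuclideanSpace ℝ (Fin d)} (hη : IsCode S F η v) (ω : ℕ → Fin N) (n : ℕ) :
    IsCode S F (history η ω n) (orbit S v ω n) := by
  induction n with
  | zero => exact hη
  | succ n ih =>
    intro I hI
    cases I with
    | nil =>
      obtain ⟨y, hy, h⟩ := ih [] trivial
      exact ⟨_, hF (ω n) y hy, by rw [orbit, ← h]; rfl⟩
    | cons i I =>
      obtain ⟨rfl, h⟩ := (begins_history_succ η ω n i I).mp hI
      obtain ⟨y, hy, h'⟩ := ih I h
      exact ⟨y, hy, by rw [orbit, ← h']; rfl⟩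

/-- The word `I` is cut at scale `b`: its ratio is at most `b`, while the ratio of the word with its
last letter removed exceeds `b`. The cut words at a given scale form an antichain. -/
def IsCut {ι : Type*} (r : ι → ℝ) (b : ℝ) (I : List ι) : Prop :=
  wordProd r I ≤ b ∧ ∀ P i, I = P ++ [i] → b < wordProd r P

lemma begins_map_range {ι : Type*} (ξ : ℕ → ι) (n : ℕ) : Begins ((List.range n).map ξ) ξ := by
  induction n generalizing ξ with
  | zero => trivial
  | succ n ih =>
    rw [List.range_succ_eq_map, List.map_cons, List.map_map]
    exact ⟨rfl, ih fun k => ξ (k + 1)⟩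

lemma exists_isCut {r : Fin N → ℝ} (hr0 : ∀ i, 0 < r i) (hr1 : ∀ i, r i < 1) {b : ℝ} (hb : 0 < b)
    (ξ : ℕ → Fin N) : ∃ I, Begins I ξ ∧ IsCut r b I := by
  classical
  obtain ⟨q, hq0, hq1, hq⟩ := exists_upper_bound_lt_one hr1
  have hex : ∃ n, wordProd r ((List.range n).map ξ) ≤ b := by
    obtain ⟨n, hn⟩ := exists_pow_lt_of_lt_one hb hq1
    refine ⟨n, (wordProd_le_pow hr0 hq _).trans ?_⟩
    simpa using hn.le
  refine ⟨_, begins_map_range ξ (Nat.find hex), Nat.find_spec hex, fun P i h => ?_⟩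
  obtain ⟨m, hm⟩ : ∃ m, Nat.find hex = m + 1 := by
    refine Nat.exists_eq_add_one_of_ne_zero fun h0 => ?_
    rw [h0] at h
    simp at h
  rw [hm, List.range_succ, List.map_append, List.map_singleton] at h
  have hP := (List.append_inj' h rfl).1
  rw [← hP]
  exact not_le.mp (Nat.find_min hex (by omega))

lemma wordProd_le_of_prefix {r : Fin N → ℝ} (hr0 : ∀ i, 0 < r i) (hr1 : ∀ i, r i < 1)
    {I J : List (Fin N)} (h : I <+: J) : wordProd r J ≤ wordProd r I := by
  obtain ⟨K, rfl⟩ := h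
  rw [wordProd_append]
  refine mul_le_of_le_one_right (wordProd_pos hr0 I).le ?_
  simpa using wordProd_le_pow hr0 (fun i => (hr1 i).le) K

lemma IsCut.eq_of_prefix {r : Fin N → ℝ} (hr0 : ∀ i, 0 < r i) (hr1 : ∀ i, r i < 1) {b : ℝ}
    {I J : List (Fin N)} (hI : IsCut r b I) (hJ : IsCut r b J) (h : I <+: J) : I = J := by
  obtain ⟨K, rfl⟩ := h
  rcases List.eq_nil_or_concat K with rfl | ⟨K', i, rfl⟩
  · simp
  · have h1 := hJ.2 (I ++ K') i (by simp)
    have h2 := wordProd_le_of_prefix hr0 hr1 (List.prefix_append I K')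
    exact absurd (h1.trans_le (h2.trans hI.1)) (lt_irrefl _)

lemma IsCut.mul_le {r : Fin N → ℝ} (hr0 : ∀ i, 0 < r i) {c b : ℝ} (hc0 : 0 < c) (hc1 : c ≤ 1)
    (hc : ∀ i, c ≤ r i) (hb : b ≤ 1) {I : List (Fin N)} (hI : IsCut r b I) :
    b * c ≤ wordProd r I := by
  rcases List.eq_nil_or_concat I with rfl | ⟨P, i, rfl⟩
  · rw [wordProd_nil]
    nlinarith
  · have h1 := hI.2 P i (by simp)
    rw [List.concat_eq_append, wordProd_append]
    simp only [wordProd_cons, wordProd_nil, mul_one]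
    exact mul_le_mul h1.le (hc i) hc0.le (wordProd_pos hr0 P).le

/-- Prefixing by `I` turns words cut at scale `r_K` into words cut at scale `r_I r_K`. -/
lemma IsCut.append {r : Fin N → ℝ} (hr0 : ∀ i, 0 < r i) (hr1 : ∀ i, r i < 1)
    {K J : List (Fin N)} (hJ : IsCut r (wordProd r K) J) (I : List (Fin N)) :
    IsCut r (wordProd r (I ++ K)) (I ++ J) := by
  have hIpos := wordProd_pos hr0 I
  refine ⟨?_, fun P i h => ?_⟩
  · rw [wordProd_append, wordProd_append]
    exact mul_le_mul_of_nonneg_left hJ.1 hIpos.le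
  · rcases List.eq_nil_or_concat J with rfl | ⟨J', j, rfl⟩
    · -- here `r_K = 1` since the empty word is cut at scale `r_K`
      have hP : wordProd r I < wordProd r P := by
        rw [List.append_nil] at h
        rw [h, wordProd_append]
        simp only [wordProd_cons, wordProd_nil, mul_one]
        exact mul_lt_of_lt_one_right (wordProd_pos hr0 P) (hr1 i)
      refine lt_of_le_of_lt ?_ hP
      exact wordProd_le_of_prefix hr0 hr1 (List.prefix_append I K)
    · have h1 := hJ.2 J' j (by simp)
      rw [List.concat_eq_append, ← List.append_assoc] at h
      rw [← (List.append_inj' h rfl).1, wordProd_append, wordProd_append]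
      exact mul_lt_mul_of_pos_left h1 hIpos

/-- Under the open set condition, incomparable words map `U` to disjoint sets. -/
lemma prefix_or_prefix_of_mem {ι X : Type*} {S : ι → X → X} {U : Set X}
    (hSi : ∀ i, Function.Injective (S i)) (hU : ∀ i, ∀ x ∈ U, S i x ∈ U)
    (hd : ∀ i j, i ≠ j → Disjoint (S i '' U) (S j '' U)) {I J : List ι} {x y : X} (hx : x ∈ U)
    (hy : y ∈ U) (h : wordMap S I x = wordMap S J y) : I <+: J ∨ J <+: I := by
  induction I generalizing J with
  | nil => exact Or.inl (List.nil_prefix)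
  | cons i I ih =>
    cases J with
    | nil => exact Or.inr (List.nil_prefix)
    | cons j J =>
      have hij : i = j := by
        by_contra hne
        exact Set.disjoint_left.mp (hd i j hne) ⟨_, wordMap_mem hU I hx, rfl⟩
          ⟨_, wordMap_mem hU J hy, h.symm⟩
      subst hij
      rcases ih (hSi i h) with h' | h'
      · exact Or.inl (List.cons_prefix_cons.mpr ⟨rfl, h'⟩)
      · exact Or.inr (List.cons_prefix_cons.mpr ⟨rfl, h'⟩)

/-- The neighbours of the word `K`: the words `J` of comparable ratio such that `S_J F` comes within
distance `r_K` of `S_K F`. -/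
def neighbours {ι X : Type*} [PseudoMetricSpace X] (S : ι → X → X) (r : ι → ℝ) (F : Set X)
    (K : List ι) : Set (List ι) :=
  {J | IsCut r (wordProd r K) J ∧ ∃ x ∈ wordMap S J '' F, ∃ z ∈ wordMap S K '' F,
    dist x z ≤ wordProd r K}

lemma append_mem_neighbours {X : Type*} [PseudoMetricSpace X] {S : Fin N → X → X} {r : Fin N → ℝ}
    (hr0 : ∀ i, 0 < r i) (hr1 : ∀ i, r i < 1)
    (hS : ∀ i u v, dist (S i u) (S i v) = r i * dist u v) {F : Set X} {K J : List (Fin N)}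
    (hJ : J ∈ neighbours S r F K) (I : List (Fin N)) : I ++ J ∈ neighbours S r F (I ++ K) := by
  obtain ⟨hc, _, ⟨x, hx, rfl⟩, _, ⟨z, hz, rfl⟩, h⟩ := hJ
  refine ⟨hc.append hr0 hr1 I, _, ⟨x, hx, rfl⟩, _, ⟨z, hz, rfl⟩, ?_⟩
  rw [wordMap_append, wordMap_append, dist_wordMap hS, wordProd_append]
  exact mul_le_mul_of_nonneg_left h (wordProd_pos hr0 I).le

lemma card_le_of_separated {X : Type*} [PseudoMetricSpace X] {B : Set X} (hB : TotallyBounded B)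
    {c : ℝ} (hc : 0 < c) : ∃ M : ℕ, ∀ {α : Type} (T : Finset α) (f : α → X), (∀ a ∈ T, f a ∈ B) →
      (∀ a ∈ T, ∀ b ∈ T, a ≠ b → c ≤ dist (f a) (f b)) → T.card ≤ M := by
  classical
  obtain ⟨t, ht, hcov⟩ := Metric.totallyBounded_iff.mp hB (c / 2) (half_pos hc)
  refine ⟨ht.toFinset.card, fun T f hf hsep => ?_⟩
  have hex : ∀ a, ∃ y, a ∈ T → y ∈ t ∧ dist (f a) y < c / 2 := fun a => by
    by_cases ha : a ∈ T
    · obtain ⟨y, hy, h⟩ : ∃ y ∈ t, dist (f a) y < c / 2 := by simpa using hcov (hf a ha)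
      exact ⟨y, fun _ => ⟨hy, h⟩⟩
    · exact ⟨f a, fun h => absurd h ha⟩
  choose g hg using hex
  refine Finset.card_le_card_of_injOn g (fun a ha => ht.mem_toFinset.mpr (hg a ha).1) ?_
  intro a ha b hb hab
  by_contra hne
  have h1 := (hg a ha).2
  have h2 := (hg b hb).2
  rw [← hab] at h2
  have := (hsep a ha b hb hne).trans (dist_triangle_right _ _ (g a))
  linarith

/-- The number of neighbours of a word is bounded, by a packing argument. -/
lemma exists_card_neighbours_le
    {S : Fin N → EuclideanSpace ℝ (Fin d) → EuclideanSpace ℝ (Fin d)} {r : Fin N → ℝ}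
    (hS : IsSimilitudeIFS S r) (hOSC : OpenSetCondition S) {F : Set (EuclideanSpace ℝ (Fin d))}
    (hF : IsAttractor S F) :
    ∃ M : ℕ, ∀ (K : List (Fin N)) (T : Finset (List (Fin N))), ↑T ⊆ neighbours S r F K →
      T.card ≤ M := by
  have hr0 : ∀ i, 0 < r i := fun i => (hS i).1
  have hr1 : ∀ i, r i < 1 := fun i => (hS i).2.1
  have hSd : ∀ i u v, dist (S i u) (S i v) = r i * dist u v := fun i => (hS i).2.2
  have hsurj : ∀ i, Function.Surjective (S i) := fun i =>
    surjective_of_dist_eq_mul (hr0 i) (hSd i)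
  have hinj : ∀ i, Function.Injective (S i) := fun i u v h => by
    have := hSd i u v
    rw [h, dist_self] at this
    exact dist_eq_zero.mp ((mul_eq_zero.mp this.symm).resolve_left (hr0 i).ne')
  obtain ⟨U, ⟨u, hu⟩, hUo, hUS, hUd⟩ := hOSC
  obtain ⟨⟨f₀, hf₀⟩, hFc, hFeq⟩ := hF
  have hU : ∀ i, ∀ x ∈ U, S i x ∈ U := fun i x hx =>
    hUS (Set.mem_iUnion.mpr ⟨i, x, hx, rfl⟩)
  obtain ⟨ε, hε, hball⟩ := Metric.isOpen_iff.mp hUo u hu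
  obtain ⟨c, hc0, hc1, hc⟩ := exists_pos_lower_bound hr0
  obtain ⟨R, hR⟩ := hFc.isBounded.subset_closedBall u
  obtain ⟨M, hM⟩ := card_le_of_separated
    (isCompact_closedBall u (3 * R + 1)).totallyBounded (mul_pos hc0 hε)
  refine ⟨M, fun K T hT => ?_⟩
  have hK := wordProd_pos hr0 K
  have hK1 : wordProd r K ≤ 1 := by
    simpa using wordProd_le_pow hr0 (fun i => (hr1 i).le) K
  -- pull the points `S_J u` back by `S_K`
  choose g hg using fun y => surjective_wordMap hsurj K y
  refine hM T (fun J => g (wordMap S J u)) (fun J hJ => ?_) fun J hJ J' hJ' hne => ?_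
  · obtain ⟨hcut, _, ⟨x, hx, rfl⟩, _, ⟨z, hz, rfl⟩, h⟩ := hT hJ
    have hd1 := dist_wordMap hSd K (g (wordMap S J u)) z
    rw [hg] at hd1
    have hxR : dist u x ≤ R := by rw [dist_comm]; exact hR hx
    have hzR : dist z u ≤ R := hR hz
    have hd2 : dist (wordMap S J u) (wordMap S J x) ≤ wordProd r K * R := by
      rw [dist_wordMap hSd]
      exact mul_le_mul hcut.1 hxR dist_nonneg hK.le
    have hd3 : wordProd r K * dist (g (wordMap S J u)) z ≤ wordProd r K * (R + 1) := by
      rw [← hd1]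
      refine (dist_triangle _ (wordMap S J x) _).trans ?_
      linarith
    have hd4 := le_of_mul_le_mul_left hd3 hK
    rw [Metric.mem_closedBall]
    have hR0 : 0 ≤ R := dist_nonneg.trans hzR
    linarith [dist_triangle (g (wordMap S J u)) z u]
  · have hcut := (hT hJ).1
    have hcut' := (hT hJ').1
    have hJc := hcut.mul_le hr0 hc0 hc1 hc hK1
    by_contra hlt
    rw [not_le] at hlt
    have hd1 := dist_wordMap hSd K (g (wordMap S J u)) (g (wordMap S J' u))
    rw [hg, hg] at hd1
    obtain ⟨y, hy⟩ := surjective_wordMap hsurj J (wordMap S J' u)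
    have hyU : y ∈ U := by
      refine hball ?_
      have hd2 := dist_wordMap hSd J u y
      rw [hy, hd1] at hd2
      have hlt' : wordProd r J * dist u y < wordProd r J * ε := by
        rw [← hd2]
        calc _ < wordProd r K * (c * ε) := mul_lt_mul_of_pos_left hlt hK
          _ = wordProd r K * c * ε := by ring
          _ ≤ _ := mul_le_mul_of_nonneg_right hJc hε.le
      rw [Metric.mem_ball, dist_comm]
      exact lt_of_mul_lt_mul_left hlt' (wordProd_pos hr0 J).le
    rcases prefix_or_prefix_of_mem hinj hU hUd hyU hu hy with h | h
    · exact hne (hcut.eq_of_prefix hr0 hr1 hcut' h)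
    · exact hne (hcut'.eq_of_prefix hr0 hr1 hcut h).symm

/-- A form of the strong open set condition (Schief): if `K` has as many neighbours as possible,
then the neighbours of `I K` are the words `I J` with `J` a neighbour of `K`. Hence only points with
codes starting with `I` come close to `S_{IK} F`. -/
lemma exists_separating_word
    {S : Fin N → EuclideanSpace ℝ (Fin d) → EuclideanSpace ℝ (Fin d)} {r : Fin N → ℝ}
    (hS : IsSimilitudeIFS S r) (hOSC : OpenSetCondition S) {F : Set (EuclideanSpace ℝ (Fin d))}
    (hF : IsAttractor S F) :
    ∃ K : List (Fin N), ∀ (I : List (Fin N)) (ξ : ℕ → Fin N) (x z : EuclideanSpace ℝ (Fin d)),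
      IsCode S F ξ x → z ∈ wordMap S (I ++ K) '' F → dist x z ≤ wordProd r (I ++ K) →
      Begins I ξ := by
  have hr0 : ∀ i, 0 < r i := fun i => (hS i).1
  have hr1 : ∀ i, r i < 1 := fun i => (hS i).2.1
  have hSd : ∀ i u v, dist (S i u) (S i v) = r i * dist u v := fun i => (hS i).2.2
  obtain ⟨M, hM⟩ := exists_card_neighbours_le hS hOSC hF
  have hfin : ∀ K, (neighbours S r F K).Finite := fun K => by
    by_contra hinf
    obtain ⟨T, hT, hcard⟩ := Set.Infinite.exists_subset_card_eq hinf (M + 1)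
    have := hM K T hT
    omega
  have hncard : ∀ K, (neighbours S r F K).ncard ≤ M := fun K => by
    rw [Set.ncard_eq_toFinset_card _ (hfin K)]
    exact hM K _ (by simp)
  obtain ⟨K, hK⟩ : ∃ K, ∀ K', (neighbours S r F K').ncard ≤ (neighbours S r F K).ncard := by
    have hbdd : BddAbove (Set.range fun K => (neighbours S r F K).ncard) :=
      ⟨M, by rintro _ ⟨K, rfl⟩; exact hncard K⟩
    obtain ⟨K, hK⟩ := Nat.sSup_mem (Set.range_nonempty _) hbdd
    refine ⟨K, fun K' => ?_⟩
    exact (le_csSup hbdd ⟨K', rfl⟩).trans hK.ge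
  refine ⟨K, fun I ξ x z hξ hz hd => ?_⟩
  have hsub : (I ++ ·) '' neighbours S r F K ⊆ neighbours S r F (I ++ K) := by
    rintro _ ⟨J, hJ, rfl⟩
    exact append_mem_neighbours hr0 hr1 hSd hJ I
  have heq := Set.eq_of_subset_of_ncard_le hsub
    (by rw [Set.ncard_image_of_injective _ (List.append_right_injective I)]; exact hK _) (hfin _)
  obtain ⟨J, hJ, hcut⟩ := exists_isCut hr0 hr1 (wordProd_pos hr0 (I ++ K)) ξ
  have hmem : J ∈ neighbours S r F (I ++ K) := ⟨hcut, x, hξ J hJ, z, hz, hd⟩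
  rw [← heq] at hmem
  obtain ⟨J', -, rfl⟩ := hmem
  exact hJ.of_prefix (List.prefix_append I J')

/-! ### From cover times to the expected waiting time -/

lemma waitingTime_le_tsum {S : Fin N → EuclideanSpace ℝ (Fin d) → EuclideanSpace ℝ (Fin d)}
    {F : Set (EuclideanSpace ℝ (Fin d))} {δ : ℝ} {v : EuclideanSpace ℝ (Fin d)} {ω : ℕ → Fin N}
    {X : ℕ → Set (ℕ → Fin N)}
    (h : ∀ n, ω ∉ X n → 1 ≤ n ∧ IsDeltaDense δ F (orbit S v ω '' Set.Icc 1 n)) :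
    (waitingTime S F δ v ω : ℝ≥0∞) ≤ ∑' n, (X n).indicator 1 ω := by
  classical
  by_cases hex : ∃ n, ω ∉ X n
  · have hW : waitingTime S F δ v ω ≤ (Nat.find hex : ℕ∞) :=
      iInf₂_le (Nat.find hex) (h _ (Nat.find_spec hex))
    calc (waitingTime S F δ v ω : ℝ≥0∞) ≤ ((Nat.find hex : ℕ∞) : ℝ≥0∞) := by exact_mod_cast hW
      _ = ∑ n ∈ Finset.range (Nat.find hex), (X n).indicator 1 ω := by
        rw [Finset.sum_congr rfl (g := fun _ => 1)]
        · simp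
        · intro n hn
          rw [Set.indicator_of_mem (not_not.mp (Nat.find_min hex (Finset.mem_range.mp hn))),
            Pi.one_apply]
      _ ≤ _ := ENNReal.sum_le_tsum _
  · push Not at hex
    have : ∀ n, (X n).indicator (1 : (ℕ → Fin N) → ℝ≥0∞) ω = 1 := fun n => by
      rw [Set.indicator_of_mem (hex n), Pi.one_apply]
    simp_rw [this]
    rw [ENNReal.tsum_const_eq_top_of_ne_zero one_ne_zero]
    exact le_top

lemma tsum_le_waitingTime {S : Fin N → EuclideanSpace ℝ (Fin d) → EuclideanSpace ℝ (Fin d)}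
    {F : Set (EuclideanSpace ℝ (Fin d))} {δ : ℝ} {v : EuclideanSpace ℝ (Fin d)} {ω : ℕ → Fin N}
    {X : ℕ → Set (ℕ → Fin N)} (hX : Antitone X)
    (h : ∀ n, 1 ≤ n → IsDeltaDense δ F (orbit S v ω '' Set.Icc 1 n) → ω ∉ X n) :
    ∑' n, (X n).indicator 1 ω ≤ (waitingTime S F δ v ω : ℝ≥0∞) := by
  rcases eq_or_ne (waitingTime S F δ v ω) ⊤ with hW | hW
  · simp [hW]
  obtain ⟨m, hm⟩ := ENat.ne_top_iff_exists.mp hW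
  obtain ⟨n, hn, hnm⟩ : ∃ n, (1 ≤ n ∧ IsDeltaDense δ F (orbit S v ω '' Set.Icc 1 n)) ∧ n ≤ m := by
    by_contra hcon
    push Not at hcon
    have : ((m + 1 : ℕ) : ℕ∞) ≤ waitingTime S F δ v ω :=
      le_iInf₂ fun n hn => by exact_mod_cast hcon n hn
    rw [← hm] at this
    have : m + 1 ≤ m := by exact_mod_cast this
    omega
  rw [← hm, tsum_eq_sum (s := Finset.range n)]
  · calc ∑ k ∈ Finset.range n, (X k).indicator (1 : (ℕ → Fin N) → ℝ≥0∞) ω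
        ≤ ∑ k ∈ Finset.range n, 1 :=
          Finset.sum_le_sum fun k _ => Set.indicator_le_self' (fun _ _ => zero_le) ω
      _ = (n : ℝ≥0∞) := by simp
      _ ≤ _ := by exact_mod_cast hnm
  · intro k hk
    rw [Finset.mem_range, not_lt] at hk
    exact Set.indicator_of_notMem (fun hc => h n hn.1 hn.2 (hX hk hc)) _

lemma one_le_expectedWaitingTime
    (S : Fin N → EuclideanSpace ℝ (Fin d) → EuclideanSpace ℝ (Fin d))
    (F : Set (EuclideanSpace ℝ (Fin d))) {p : Fin N → ℝ} (hp : IsNondegenerateProbVector p)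
    (δ : ℝ) (v : EuclideanSpace ℝ (Fin d)) : 1 ≤ expectedWaitingTime S F p δ v := by
  have := isProbabilityMeasure_bernoulli hp
  calc (1 : ℝ≥0∞) = ∫⁻ _, 1 ∂(bernoulliMeasure p) := by simp
    _ ≤ _ := lintegral_mono fun ω => by
      have : (1 : ℕ∞) ≤ waitingTime S F δ v ω := le_iInf₂ fun n hn => by exact_mod_cast hn.1
      rw [← ENat.toENNReal_one]
      exact ENat.toENNReal_le.mpr this

lemma orbit_mem {S : Fin N → EuclideanSpace ℝ (Fin d) → EuclideanSpace ℝ (Fin d)}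
    {F : Set (EuclideanSpace ℝ (Fin d))} (hF : ∀ i, ∀ x ∈ F, S i x ∈ F)
    {v : EuclideanSpace ℝ (Fin d)} (hv : v ∈ F) (ω : ℕ → Fin N) (n : ℕ) : orbit S v ω n ∈ F := by
  induction n with
  | zero => exact hv
  | succ n ih => exact hF _ _ ih

lemma IsAttractor.map_mem {S : Fin N → EuclideanSpace ℝ (Fin d) → EuclideanSpace ℝ (Fin d)}
    {F : Set (EuclideanSpace ℝ (Fin d))} (hF : IsAttractor S F) (i : Fin N)
    {x : EuclideanSpace ℝ (Fin d)} (hx : x ∈ F) : S i x ∈ F := by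
  rw [hF.2.2]
  exact Set.mem_iUnion.mpr ⟨i, x, hx, rfl⟩

lemma exp_inv_one_sub_le {β : ℝ} (hβ : 0 < β) : (1 - Real.exp (-β))⁻¹ ≤ 1 + 1 / β := by
  have h1 : 1 + β ≤ Real.exp β := by linarith [Real.add_one_le_exp β]
  have h2 : Real.exp (-β) ≤ (1 + β)⁻¹ := by
    rw [Real.exp_neg]
    exact inv_anti₀ (by linarith) h1
  have h3 : β / (1 + β) ≤ 1 - Real.exp (-β) := by
    have : β / (1 + β) = 1 - (1 + β)⁻¹ := by field_simp; ring
    linarith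
  calc (1 - Real.exp (-β))⁻¹ ≤ (β / (1 + β))⁻¹ := inv_anti₀ (by positivity) h3
    _ = 1 + 1 / β := by field_simp; ring

lemma tsum_le_of_exp_tail {f : ℕ → ℝ≥0∞} {A β x : ℝ} (hA : 0 ≤ A) (hβ : 0 < β) (hx : 0 ≤ x)
    (h1 : ∀ n, f n ≤ 1) (hf : ∀ n : ℕ, f n ≤ ENNReal.ofReal (A * Real.exp (-(β * (n - x))))) :
    ∑' n, f n ≤ ENNReal.ofReal (x + 1 + A * (1 + 1 / β)) := by
  set m := ⌈x⌉₊ with hm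
  have hm1 : (m : ℝ) ≤ x + 1 := (Nat.ceil_lt_add_one hx).le
  have hm2 : x ≤ m := Nat.le_ceil x
  have he0 : (0 : ℝ) < Real.exp (-β) := Real.exp_pos _
  have he1 : Real.exp (-β) < 1 := Real.exp_lt_one_iff.mpr (by linarith)
  have hk : ∀ k, f (k + m) ≤ ENNReal.ofReal (A * Real.exp (-β) ^ k) := fun k => by
    refine (hf _).trans (ENNReal.ofReal_le_ofReal (mul_le_mul_of_nonneg_left ?_ hA))
    rw [← Real.exp_nat_mul, Real.exp_le_exp]
    push_cast
    nlinarith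
  have hsum : ∑' k, ENNReal.ofReal (A * Real.exp (-β) ^ k) ≤
      ENNReal.ofReal (A * (1 + 1 / β)) := by
    rw [← ENNReal.ofReal_tsum_of_nonneg (fun k => by positivity)
      ((summable_geometric_of_lt_one he0.le he1).mul_left A), tsum_mul_left,
      tsum_geometric_of_lt_one he0.le he1]
    exact ENNReal.ofReal_le_ofReal (mul_le_mul_of_nonneg_left (exp_inv_one_sub_le hβ) hA)
  rw [← Summable.sum_add_tsum_nat_add' (f := f) (k := m) ENNReal.summable,
    ENNReal.ofReal_add (by positivity) (by positivity)]
  refine add_le_add ?_ ((ENNReal.tsum_le_tsum hk).trans hsum)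
  calc ∑ n ∈ Finset.range m, f n ≤ ∑ n ∈ Finset.range m, 1 := Finset.sum_le_sum fun n _ => h1 n
    _ = ENNReal.ofReal m := by simp
    _ ≤ _ := ENNReal.ofReal_le_ofReal hm1

/-- Some word cut at scale `b` has not occurred by time `n`. -/
def uncoveredCuts (r : Fin N → ℝ) (b : ℝ) (η : ℕ → Fin N) (n : ℕ) : Set (ℕ → Fin N) :=
  {ω | ∃ I, IsCut r b I ∧ ω ∈ unseen η I n}

lemma isPast_uncoveredCuts (r : Fin N → ℝ) (b : ℝ) (η : ℕ → Fin N) (n : ℕ) :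
    IsPast n (uncoveredCuts r b η n) := fun ω ω' hω ⟨I, hI, hu⟩ =>
  ⟨I, hI, isPast_unseen η I le_rfl ω ω' hω hu⟩

/-- Once all words cut at scale `δ / (diam F + 1)` have occurred, the orbit is `δ`-dense. -/
lemma expectedWaitingTime_le_of_tail
    {S : Fin N → EuclideanSpace ℝ (Fin d) → EuclideanSpace ℝ (Fin d)} {r : Fin N → ℝ}
    (hS : IsSimilitudeIFS S r) {F : Set (EuclideanSpace ℝ (Fin d))} (hF : IsAttractor S F)
    {p : Fin N → ℝ} (hp : IsNondegenerateProbVector p) {δ : ℝ} (hδ : 0 < δ)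
    {v : EuclideanSpace ℝ (Fin d)} (hv : v ∈ F) {A β x : ℝ} (hA : 0 ≤ A) (hβ : 0 < β) (hx : 0 ≤ x)
    (h : ∀ (η : ℕ → Fin N) (n : ℕ),
      (bernoulliMeasure p).real (uncoveredCuts r (δ / (Metric.diam F + 1)) η n) ≤
        A * Real.exp (-(β * (n - x)))) :
    expectedWaitingTime S F p δ v ≤ ENNReal.ofReal (x + 1 + A * (1 + 1 / β)) := by
  have := isProbabilityMeasure_bernoulli hp
  have hr0 : ∀ i, 0 < r i := fun i => (hS i).1
  have hr1 : ∀ i, r i < 1 := fun i => (hS i).2.1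
  have hSd : ∀ i u v, dist (S i u) (S i v) = r i * dist u v := fun i => (hS i).2.2
  have hFS : ∀ i, ∀ x ∈ F, S i x ∈ F := fun i x hx => hF.map_mem i hx
  have hdiam : 0 < Metric.diam F + 1 := by linarith [Metric.diam_nonneg (s := F)]
  set b := δ / (Metric.diam F + 1) with hb
  have hb0 : 0 < b := by positivity
  obtain ⟨η, hη⟩ := exists_isCode hF.2.2.subset hv
  have hW : ∀ ω, (waitingTime S F δ v ω : ℝ≥0∞) ≤
      ∑' n, (uncoveredCuts r b η n).indicator 1 ω := fun ω => by
    refine waitingTime_le_tsum fun n hn => ⟨?_, ?_, fun z hz => ?_⟩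
    · by_contra h0
      obtain rfl : n = 0 := by omega
      obtain ⟨I, -, hI⟩ := exists_isCut hr0 hr1 hb0 η
      exact hn ⟨I, hI, fun k h1 h2 => absurd h1 (by omega)⟩
    · rintro _ ⟨k, -, rfl⟩
      exact orbit_mem hFS hv ω k
    · obtain ⟨ξ, hξ⟩ := exists_isCode hF.2.2.subset hz
      obtain ⟨I, hI, hcut⟩ := exists_isCut hr0 hr1 hb0 ξ
      have hseen : ω ∉ unseen η I n := fun hu => hn ⟨I, hcut, hu⟩
      simp only [unseen, Set.mem_ofPred_eq, not_forall, not_not] at hseen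
      obtain ⟨k, hk1, hk2, hk⟩ := hseen
      refine ⟨_, ⟨k, ⟨hk1, hk2⟩, rfl⟩, ?_⟩
      obtain ⟨y, hy, hyx⟩ := isCode_history hFS hη ω k I hk
      obtain ⟨z', hz', hzz⟩ := hξ I hI
      rw [← hyx, ← hzz, dist_wordMap hSd]
      calc wordProd r I * dist y z' ≤ b * (Metric.diam F + 1) :=
            mul_le_mul hcut.1 ((Metric.dist_le_diam_of_mem hF.2.1.isBounded hy hz').trans
              (by linarith)) dist_nonneg hb0.le
        _ = δ := by rw [hb]; field_simp
  calc expectedWaitingTime S F p δ v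
      ≤ ∫⁻ ω, ∑' n, (uncoveredCuts r b η n).indicator 1 ω ∂(bernoulliMeasure p) :=
        lintegral_mono hW
    _ = ∑' n, bernoulliMeasure p (uncoveredCuts r b η n) := by
        rw [lintegral_tsum fun n => (measurable_one.indicator
          (isPast_uncoveredCuts r b η n).measurableSet).aemeasurable]
        exact tsum_congr fun n => lintegral_indicator_one
          (isPast_uncoveredCuts r b η n).measurableSet
    _ ≤ _ := tsum_le_of_exp_tail hA hβ hx (fun n => prob_le_one) fun n => by
        rw [← ofReal_measureReal]
        exact ENNReal.ofReal_le_ofReal (h η n)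

lemma wordProd_ofFn (a : Fin N → ℝ) {l : ℕ} (f : Fin l → Fin N) :
    wordProd a (List.ofFn f) = ∏ k, a (f k) := by
  rw [wordProd, List.map_ofFn, List.prod_ofFn]
  rfl

/-- Union bound over the cut words; the multiplicative weights `a` sum up to a geometric sum. -/
lemma measureReal_uncoveredCuts_le {r : Fin N → ℝ} {p : Fin N → ℝ}
    (hp : IsNondegenerateProbVector p) {b : ℝ} {η : ℕ → Fin N} {n L : ℕ}
    (hL : ∀ I : List (Fin N), IsCut r b I → I.length ≤ L) {a : Fin N → ℝ} (ha : ∀ i, 0 ≤ a i)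
    (ha1 : 1 ≤ ∑ i, a i) {Y : ℝ} (hY : 0 ≤ Y)
    (h : ∀ I, IsCut r b I → (bernoulliMeasure p).real (unseen η I n) ≤ Y * wordProd a I) :
    (bernoulliMeasure p).real (uncoveredCuts r b η n) ≤ Y * ((L + 1) * (∑ i, a i) ^ L) := by
  classical
  have := isProbabilityMeasure_bernoulli hp
  set X : (l : ℕ) → (Fin l → Fin N) → Set (ℕ → Fin N) := fun l f =>
    if IsCut r b (List.ofFn f) then unseen η (List.ofFn f) n else ∅ with hX
  have hsub : uncoveredCuts r b η n ⊆ ⋃ l ∈ Finset.range (L + 1), ⋃ f : Fin l → Fin N, X l f := by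
    rintro ω ⟨I, hI, hu⟩
    simp only [Set.mem_iUnion]
    refine ⟨I.length, Finset.mem_range.mpr (Nat.lt_succ_of_le (hL I hI)), I.get, ?_⟩
    simp only [hX, List.ofFn_get]
    rwa [if_pos hI]
  have hXle : ∀ l (f : Fin l → Fin N), (bernoulliMeasure p).real (X l f) ≤ Y * ∏ k, a (f k) := by
    intro l f
    simp only [hX]
    split_ifs with hI
    · rw [← wordProd_ofFn]
      exact h _ hI
    · simpa using mul_nonneg hY (Finset.prod_nonneg fun k _ => ha (f k))
  calc (bernoulliMeasure p).real (uncoveredCuts r b η n)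
      ≤ (bernoulliMeasure p).real
          (⋃ l ∈ Finset.range (L + 1), ⋃ f : Fin l → Fin N, X l f) :=
        measureReal_mono hsub (measure_ne_top _ _)
    _ ≤ ∑ l ∈ Finset.range (L + 1), (bernoulliMeasure p).real (⋃ f : Fin l → Fin N, X l f) :=
        measureReal_biUnion_finset_le _ _
    _ ≤ ∑ l ∈ Finset.range (L + 1), ∑ f : Fin l → Fin N, Y * ∏ k, a (f k) :=
        Finset.sum_le_sum fun l _ => (measureReal_iUnion_fintype_le _).trans
          (Finset.sum_le_sum fun f _ => hXle l f)
    _ = ∑ l ∈ Finset.range (L + 1), Y * (∑ i, a i) ^ l :=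
        Finset.sum_congr rfl fun l _ => by rw [← Finset.mul_sum, ← Fintype.sum_pow]
    _ ≤ ∑ l ∈ Finset.range (L + 1), Y * (∑ i, a i) ^ L :=
        Finset.sum_le_sum fun l hl => mul_le_mul_of_nonneg_left
          (pow_le_pow_right₀ ha1 (Nat.lt_succ_iff.mp (Finset.mem_range.mp hl))) hY
    _ = _ := by
        rw [Finset.sum_const, Finset.card_range, nsmul_eq_mul]
        push_cast
        ring

/-! ### The upper bounds -/

lemma IsNondegenerateProbVector.lt_one {p : Fin N → ℝ} (hp : IsNondegenerateProbVector p)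
    (hN : 2 ≤ N) (i : Fin N) : p i < 1 := by
  have : Nontrivial (Fin N) := Fin.nontrivial_iff_two_le.mpr hN
  obtain ⟨j, hj⟩ := exists_ne i
  have h := Finset.sum_le_univ_sum_of_nonneg (s := {i, j}) fun k => (hp.1 k).le
  rw [hp.2, Finset.sum_pair hj.symm] at h
  linarith [hp.1 j]

lemma div_log_le_iff {a b t : ℝ} (ha : 0 < a) (hb0 : 0 < b) (hb1 : b < 1) :
    Real.log a / Real.log b ≤ t ↔ b ^ t ≤ a := by
  rw [div_le_iff_of_neg (Real.log_neg hb0 hb1), ← Real.log_rpow hb0,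
    Real.log_le_log_iff (Real.rpow_pos_of_pos hb0 t) ha]

lemma div_log_eq_iff {a b t : ℝ} (ha : 0 < a) (hb0 : 0 < b) (hb1 : b < 1) :
    Real.log a / Real.log b = t ↔ a = b ^ t := by
  rw [div_eq_iff (Real.log_neg hb0 hb1).ne, ← Real.log_rpow hb0]
  exact ⟨fun h => Real.log_injOn_pos ha (Real.rpow_pos_of_pos hb0 t) h, fun h => by rw [h]⟩

lemma rpow_exponent_le {p r : Fin N → ℝ} (hp : ∀ i, 0 < p i) (hr0 : ∀ i, 0 < r i)
    (hr1 : ∀ i, r i < 1) (i : Fin N) : r i ^ exponent p r ≤ p i :=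
  (div_log_le_iff (hp i) (hr0 i) (hr1 i)).mp (le_ciSup (Set.finite_range
    fun i => Real.log (p i) / Real.log (r i)).bddAbove i)

lemma exponent_pos {p r : Fin N → ℝ} (hN : 2 ≤ N) (hp : IsNondegenerateProbVector p)
    (hr0 : ∀ i, 0 < r i) (hr1 : ∀ i, r i < 1) : 0 < exponent p r := by
  have i : Fin N := ⟨0, by omega⟩
  exact (div_pos_of_neg_of_neg (Real.log_neg (hp.1 i) (hp.lt_one hN i))
    (Real.log_neg (hr0 i) (hr1 i))).trans_le (le_ciSup (Set.finite_range
    fun i => Real.log (p i) / Real.log (r i)).bddAbove i)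

lemma wordProd_rpow {r : Fin N → ℝ} (hr0 : ∀ i, 0 < r i) (t : ℝ) (I : List (Fin N)) :
    wordProd (fun i => r i ^ t) I = wordProd r I ^ t := by
  induction I with
  | nil => simp
  | cons i I ih =>
    rw [wordProd_cons, wordProd_cons, ih, Real.mul_rpow (hr0 i).le (wordProd_pos hr0 I).le]

lemma wordProd_mono {a b : Fin N → ℝ} (ha : ∀ i, 0 < a i) (hab : ∀ i, a i ≤ b i)
    (I : List (Fin N)) : wordProd a I ≤ wordProd b I := by
  induction I with
  | nil => simp
  | cons i I ih =>
    rw [wordProd_cons, wordProd_cons]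
    exact mul_le_mul (hab i) ih (wordProd_pos ha I).le ((ha i).le.trans (hab i))

lemma wordProd_mul (a b : Fin N → ℝ) (I : List (Fin N)) :
    wordProd (fun i => a i * b i) I = wordProd a I * wordProd b I := by
  induction I with
  | nil => simp
  | cons i I ih =>
    rw [wordProd_cons, wordProd_cons, wordProd_cons, ih]
    ring

lemma wordProd_ite (i₀ : Fin N) (y : ℝ) (I : List (Fin N)) :
    wordProd (fun i => if i = i₀ then 1 else y) I = y ^ I.countP (· ≠ i₀) := by
  induction I with
  | nil => simp
  | cons i I ih =>
    rw [wordProd_cons, ih, List.countP_cons]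
    by_cases h : i = i₀
    · simp [h]
    · simp [h, pow_succ']

/-- The words cut at a scale comparable to `δ` have length `O(log (1 / δ))`. -/
lemma exists_length_isCut_le {r : Fin N → ℝ} (hN : 2 ≤ N) (hr0 : ∀ i, 0 < r i)
    (hr1 : ∀ i, r i < 1) {D : ℝ} (hD : 0 ≤ D) :
    ∃ C : ℝ, 1 ≤ C ∧ ∀ δ : ℝ, 0 < δ → (∀ i, δ < r i) → ∃ L : ℕ,
      (L : ℝ) + 1 ≤ C * Real.log (1 / δ) ∧ ∀ I, IsCut r (δ / (D + 1)) I → I.length ≤ L := by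
  obtain ⟨q, hq0, hq1, hq⟩ := exists_upper_bound_lt_one hr1
  have i₀ : Fin N := ⟨0, by omega⟩
  set l₀ := Real.log (1 / r i₀) with hl₀
  have hl₀pos : 0 < l₀ := Real.log_pos (by rw [lt_div_iff₀ (hr0 i₀), one_mul]; exact hr1 i₀)
  set lq := Real.log (1 / q) with hlq
  have hlqpos : 0 < lq := Real.log_pos (by rw [lt_div_iff₀ hq0, one_mul]; exact hq1)
  have hlD : 0 ≤ Real.log (D + 1) := Real.log_nonneg (by linarith)
  refine ⟨1 + 1 / lq + (2 + Real.log (D + 1) / lq) / l₀, ?_, fun δ hδ hδr => ?_⟩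
  · have : 0 ≤ 1 / lq + (2 + Real.log (D + 1) / lq) / l₀ := by positivity
    linarith
  have hl : l₀ ≤ Real.log (1 / δ) := Real.log_le_log (by have := hr0 i₀; positivity)
    (one_div_le_one_div_of_le hδ (hδr i₀).le)
  set l := Real.log (1 / δ) with hldef
  set b := δ / (D + 1) with hb
  have hb0 : 0 < b := by positivity
  have hlb : Real.log (1 / b) = l + Real.log (D + 1) := by
    rw [hldef, hb, ← Real.log_mul (by positivity) (by positivity)]
    congr 1
    field_simp
  have hlpos : 0 < l := hl₀pos.trans_le hl
  refine ⟨1 + ⌊(l + Real.log (D + 1)) / lq⌋₊, ?_, fun I hI => ?_⟩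
  · have h1 : (⌊(l + Real.log (D + 1)) / lq⌋₊ : ℝ) ≤ l / lq + Real.log (D + 1) / lq :=
      (Nat.floor_le (by positivity)).trans_eq (add_div _ _ _)
    have h2 : 2 + Real.log (D + 1) / lq ≤ (2 + Real.log (D + 1) / lq) / l₀ * l := by
      rw [div_mul_eq_mul_div, le_div_iff₀ hl₀pos]
      exact mul_le_mul_of_nonneg_left hl (by positivity)
    push_cast
    have h3 : l / lq = 1 / lq * l := by ring
    rw [add_mul, add_mul, one_mul, ← h3]
    linarith
  · rcases List.eq_nil_or_concat I with rfl | ⟨P, i, rfl⟩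
    · simp
    · have h1 := (hI.2 P i (by simp)).trans_le (wordProd_le_pow hr0 hq P)
      have h2 := Real.log_lt_log hb0 h1
      rw [Real.log_pow] at h2
      have h3 : Real.log b = -(l + Real.log (D + 1)) := by
        rw [← hlb, one_div, Real.log_inv, neg_neg]
      have h4 : Real.log q = -lq := by rw [hlq, one_div, Real.log_inv, neg_neg]
      rw [h3, h4] at h2
      have h5 : P.length ≤ ⌊(l + Real.log (D + 1)) / lq⌋₊ := by
        refine Nat.le_floor ?_
        rw [le_div_iff₀ hlqpos]
        linarith
      rw [List.concat_eq_append, List.length_append, List.length_singleton]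
      omega

/-- The ratio of a word cut at a scale comparable to `δ` is at least comparable to `δ`. -/
lemma exists_mul_rpow_le_wordProd {r : Fin N → ℝ} (hr0 : ∀ i, 0 < r i) {D t : ℝ} (hD : 0 ≤ D)
    (ht : 0 ≤ t) : ∃ κ : ℝ, 0 < κ ∧ ∀ δ : ℝ, 0 < δ → δ < 1 → ∀ I, IsCut r (δ / (D + 1)) I →
      κ * δ ^ t ≤ wordProd r I ^ t := by
  obtain ⟨c, hc0, hc1, hc⟩ := exists_pos_lower_bound hr0
  refine ⟨(c / (D + 1)) ^ t, by positivity, fun δ hδ hδ1 I hI => ?_⟩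
  have hb : δ / (D + 1) ≤ 1 := by
    rw [div_le_one (by linarith)]
    linarith
  have h := hI.mul_le hr0 hc0 hc1 hc hb
  rw [← Real.mul_rpow (by positivity) hδ.le]
  refine Real.rpow_le_rpow (by positivity) (le_trans (le_of_eq ?_) h) ht
  ring

/-- The upper bound `δ ^ (-t) log (1 / δ)`: there are `exp (O(log (1 / δ)))` cut words, each of which
has probability at least of order `δ ^ t`. -/
lemma exists_expectedWaitingTime_le_log
    {S : Fin N → EuclideanSpace ℝ (Fin d) → EuclideanSpace ℝ (Fin d)} {r : Fin N → ℝ}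
    (hN : 2 ≤ N) (hS : IsSimilitudeIFS S r) {F : Set (EuclideanSpace ℝ (Fin d))}
    (hF : IsAttractor S F) {p : Fin N → ℝ} (hp : IsNondegenerateProbVector p) {t : ℝ} (ht : 0 < t)
    (hrp : ∀ i, r i ^ t ≤ p i) :
    ∃ C : ℝ, 0 < C ∧ ∀ v ∈ F, ∀ δ : ℝ, 0 < δ → (∀ i, δ < r i) →
      expectedWaitingTime S F p δ v ≤ ENNReal.ofReal (C * δ ^ (-t) * Real.log (1 / δ)) := by
  have hr0 : ∀ i, 0 < r i := fun i => (hS i).1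
  have hr1 : ∀ i, r i < 1 := fun i => (hS i).2.1
  have hD : 0 ≤ Metric.diam F := Metric.diam_nonneg
  obtain ⟨q, hq0, hq1, hq⟩ := exists_upper_bound_lt_one (hp.lt_one hN)
  obtain ⟨CL, hCL, hlen⟩ := exists_length_isCut_le hN hr0 hr1 hD
  obtain ⟨κ, hκ, hcut⟩ := exists_mul_rpow_le_wordProd hr0 hD ht.le
  set c := (1 - q) * Real.log 2 / 4 with hc
  have hc0 : 0 < c := by
    have := Real.log_pos one_lt_two
    have : 0 < 1 - q := by linarith
    positivity
  have i₀ : Fin N := ⟨0, by omega⟩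
  set l₀ := Real.log (1 / r i₀) with hl₀
  have hl₀pos : 0 < l₀ := Real.log_pos (by rw [lt_div_iff₀ (hr0 i₀), one_mul]; exact hr1 i₀)
  have hN1 : (2 : ℝ) ≤ N := by exact_mod_cast hN
  have hlogN : 0 < Real.log (2 * N) := Real.log_pos (by linarith)
  refine ⟨CL * Real.log (2 * N) / (c * κ) + 3 / l₀ + 2 / (c * κ * l₀), by positivity,
    fun v hv δ hδ hδr => ?_⟩
  have hδ1 : δ < 1 := (hδr i₀).trans (hr1 i₀)
  obtain ⟨L, hL, hlenL⟩ := hlen δ hδ hδr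
  have hl : l₀ ≤ Real.log (1 / δ) := Real.log_le_log (by have := hr0 i₀; positivity)
    (one_div_le_one_div_of_le hδ (hδr i₀).le)
  set l := Real.log (1 / δ) with hldef
  set T := δ ^ (-t) with hT
  have hT1 : 1 ≤ T := Real.one_le_rpow_of_pos_of_le_one_of_nonpos hδ hδ1.le (by linarith)
  have hδT : δ ^ t = T⁻¹ := by rw [hT, Real.rpow_neg hδ.le, inv_inv]
  set β := c * κ * δ ^ t with hβ
  have hδt : 0 < δ ^ t := Real.rpow_pos_of_pos hδ t
  have hβ0 : 0 < β := by positivity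
  set x := L * Real.log (2 * N) / β with hx
  have hx0 : 0 ≤ x := by positivity
  have htail : ∀ (η : ℕ → Fin N) (n : ℕ),
      (bernoulliMeasure p).real (uncoveredCuts r (δ / (Metric.diam F + 1)) η n) ≤
        2 * Real.exp (-(β * (n - x))) := by
    intro η n
    have hunseen : ∀ I, IsCut r (δ / (Metric.diam F + 1)) I →
        (bernoulliMeasure p).real (unseen η I n) ≤
          2 * Real.exp (-(β * n)) * wordProd (fun _ => 1) I := by
      intro I hI
      have h1 : wordProd (fun _ : Fin N => (1 : ℝ)) I = 1 := by simp [wordProd]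
      rw [h1, mul_one]
      refine (measureReal_unseen_le hp hq hq0.le hq1 η I n).trans ?_
      refine mul_le_mul_of_nonneg_left (Real.exp_le_exp.mpr (neg_le_neg ?_)) two_pos.le
      refine mul_le_mul_of_nonneg_right ?_ (Nat.cast_nonneg n)
      rw [hβ, mul_assoc]
      refine mul_le_mul_of_nonneg_left ((hcut δ hδ hδ1 I hI).trans ?_) hc0.le
      rw [← wordProd_rpow hr0]
      exact wordProd_mono (fun i => Real.rpow_pos_of_pos (hr0 i) t) hrp I
    refine (measureReal_uncoveredCuts_le hp hlenL (a := fun _ => 1) (fun _ => zero_le_one)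
      (by simp; omega) (by positivity) hunseen).trans ?_
    have hexp : Real.exp (-(β * (n - x))) = Real.exp (-(β * n)) * (2 * N) ^ L := by
      have h1 : -(β * (n - x)) = -(β * n) + L * Real.log (2 * N) := by
        rw [hx]
        field_simp
        ring
      rw [h1, Real.exp_add, Real.exp_nat_mul, Real.exp_log (by linarith)]
    rw [hexp, mul_assoc]
    have h2 : (L : ℝ) + 1 ≤ 2 ^ L := by exact_mod_cast Nat.lt_two_pow_self (n := L)
    simp only [Finset.sum_const, Finset.card_univ, Fintype.card_fin, nsmul_eq_mul, mul_one]
    rw [mul_pow]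
    gcongr
  refine (expectedWaitingTime_le_of_tail hS hF hp hδ hv zero_le_two hβ0 hx0 htail).trans
    (ENNReal.ofReal_le_ofReal ?_)
  have hlpos : 0 < l := hl₀pos.trans_le hl
  have hβinv : 1 / β = T / (c * κ) := by
    rw [hβ, hδT]
    field_simp
  have e1 : x ≤ CL * Real.log (2 * N) / (c * κ) * T * l := by
    have : x = L * (Real.log (2 * N) / (c * κ) * T) := by
      rw [hx, div_eq_mul_one_div, hβinv]
      ring
    rw [this]
    calc L * (Real.log (2 * N) / (c * κ) * T)
        ≤ CL * l * (Real.log (2 * N) / (c * κ) * T) :=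
          mul_le_mul_of_nonneg_right (by linarith) (by positivity)
      _ = _ := by ring
  have hll : 1 ≤ l / l₀ := (one_le_div hl₀pos).mpr hl
  have e2 : 3 ≤ 3 / l₀ * T * l := by
    have : 3 / l₀ * T * l = 3 * (T * (l / l₀)) := by ring
    rw [this]
    nlinarith
  have e3 : 2 * (1 / β) ≤ 2 / (c * κ * l₀) * T * l := by
    have : 2 / (c * κ * l₀) * T * l = 2 * (T / (c * κ)) * (l / l₀) := by
      field_simp
    rw [this, hβinv]
    exact le_mul_of_one_le_right (by positivity) hll
  linarith

/-- The upper bound `δ ^ (-t) log log (1 / δ)` when `r i ^ t = p i` holds for at most one letter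
`i₀`: a word with `k` letters other than `i₀` has probability at least of order `(k + 1) δ ^ t`, which
outweighs the number of these words. -/
lemma exists_expectedWaitingTime_le_log_log
    {S : Fin N → EuclideanSpace ℝ (Fin d) → EuclideanSpace ℝ (Fin d)} {r : Fin N → ℝ}
    (hN : 2 ≤ N) (hS : IsSimilitudeIFS S r) {F : Set (EuclideanSpace ℝ (Fin d))}
    (hF : IsAttractor S F) {p : Fin N → ℝ} (hp : IsNondegenerateProbVector p) {t : ℝ} (ht : 0 < t)
    {i₀ : Fin N} (hrp₀ : r i₀ ^ t ≤ p i₀) (hrp : ∀ i, i ≠ i₀ → r i ^ t < p i) :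
    ∃ C : ℝ, 0 < C ∧ ∀ v ∈ F, ∀ δ : ℝ, 0 < δ → (∀ i, δ < r i) →
      expectedWaitingTime S F p δ v ≤
        ENNReal.ofReal (C * δ ^ (-t) * max 1 (Real.log (Real.log (1 / δ)))) := by
  have hr0 : ∀ i, 0 < r i := fun i => (hS i).1
  have hr1 : ∀ i, r i < 1 := fun i => (hS i).2.1
  have hrt : ∀ i, 0 < r i ^ t := fun i => Real.rpow_pos_of_pos (hr0 i) t
  have hD : 0 ≤ Metric.diam F := Metric.diam_nonneg
  obtain ⟨q, hq0, hq1, hq⟩ := exists_upper_bound_lt_one (hp.lt_one hN)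
  obtain ⟨CL, hCL, hlen⟩ := exists_length_isCut_le hN hr0 hr1 hD
  obtain ⟨κ, hκ, hcut⟩ := exists_mul_rpow_le_wordProd hr0 hD ht.le
  set c := (1 - q) * Real.log 2 / 4 with hc
  have hc0 : 0 < c := by
    have := Real.log_pos one_lt_two
    have : 0 < 1 - q := by linarith
    positivity
  obtain ⟨lam, hlam1, hlam⟩ : ∃ lam : ℝ, 1 < lam ∧
      ∀ i, r i ^ t * (if i = i₀ then 1 else lam) ≤ p i := by
    obtain ⟨e, he0, he1, he⟩ := exists_upper_bound_lt_one
      (f := fun i => if i = i₀ then 1 / 2 else r i ^ t / p i) fun i => by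
        split_ifs with h
        · norm_num
        · exact (div_lt_one (hp.1 i)).mpr (hrp i h)
    refine ⟨e⁻¹, (one_lt_inv₀ he0).mpr he1, fun i => ?_⟩
    have := he i
    split_ifs at this ⊢ with h
    · rw [mul_one, h]
      exact hrp₀
    · rwa [div_le_iff₀ (hp.1 i), ← div_le_iff₀' he0, div_eq_mul_inv] at this
  set ν := min 1 (lam - 1) with hν
  have hν0 : 0 < ν := lt_min one_pos (by linarith)
  set B := c * κ * ν with hB
  have hB0 : 0 < B := by positivity
  have hlogCL : 0 ≤ Real.log CL := Real.log_nonneg hCL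
  refine ⟨(Real.log CL + 1) / B + (1 + 2 * Real.exp N) + 2 * Real.exp N / B, by positivity,
    fun v hv δ hδ hδr => ?_⟩
  have hδ1 : δ < 1 := (hδr i₀).trans (hr1 i₀)
  obtain ⟨L, hL, hlenL⟩ := hlen δ hδ hδr
  set l := Real.log (1 / δ) with hldef
  have hlpos : 0 < l := Real.log_pos (by rw [lt_div_iff₀ hδ, one_mul]; exact hδ1)
  set m := max 1 (Real.log l) with hm
  have hm1 : 1 ≤ m := le_max_left _ _
  set T := δ ^ (-t) with hT
  have hT1 : 1 ≤ T := Real.one_le_rpow_of_pos_of_le_one_of_nonpos hδ hδ1.le (by linarith)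
  have hδT : δ ^ t = T⁻¹ := by rw [hT, Real.rpow_neg hδ.le, inv_inv]
  set β := B * δ ^ t with hβ
  have hδt : 0 < δ ^ t := Real.rpow_pos_of_pos hδ t
  have hβ0 : 0 < β := by positivity
  have hL1 : (1 : ℝ) ≤ (L : ℝ) + 1 := by linarith [Nat.cast_nonneg (α := ℝ) L]
  set x := Real.log (L + 1) / β with hx
  have hx0 : 0 ≤ x := div_nonneg (Real.log_nonneg hL1) hβ0.le
  have htail : ∀ (η : ℕ → Fin N) (n : ℕ),
      (bernoulliMeasure p).real (uncoveredCuts r (δ / (Metric.diam F + 1)) η n) ≤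
        2 * Real.exp N * Real.exp (-(β * (n - x))) := by
    intro η n
    have := isProbabilityMeasure_bernoulli hp
    have hexpN : 1 ≤ Real.exp N := Real.one_le_exp (Nat.cast_nonneg N)
    rcases le_total (n : ℝ) x with hnx | hnx
    · have h1 : 1 ≤ Real.exp (-(β * (n - x))) := Real.one_le_exp (by nlinarith)
      refine measureReal_le_one.trans ?_
      nlinarith
    set y := Real.exp (-(β * n)) with hy
    have hy0 : 0 < y := Real.exp_pos _
    have hunseen : ∀ I, IsCut r (δ / (Metric.diam F + 1)) I →
        (bernoulliMeasure p).real (unseen η I n) ≤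
          2 * y * wordProd (fun i => if i = i₀ then 1 else y) I := by
      intro I hI
      set k := I.countP (· ≠ i₀) with hk
      have hpI : κ * δ ^ t * (ν * (k + 1)) ≤ wordProd p I := by
        have h1 : wordProd r I ^ t * lam ^ k ≤ wordProd p I := by
          rw [← wordProd_rpow hr0, ← wordProd_ite, ← wordProd_mul]
          refine wordProd_mono (fun i => mul_pos (hrt i) ?_) hlam I
          split_ifs <;> linarith
        have h2 : ν * (k + 1) ≤ lam ^ k := by
          have h3 := one_add_mul_sub_le_pow (a := lam) (by linarith) k
          have h4 : ν * k ≤ k * (lam - 1) := by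
            rw [mul_comm]
            exact mul_le_mul_of_nonneg_left (min_le_right _ _) (Nat.cast_nonneg k)
          have h5 : ν ≤ 1 := min_le_left _ _
          linarith
        exact (mul_le_mul (hcut δ hδ hδ1 I hI) h2 (by positivity)
          (Real.rpow_nonneg (wordProd_pos hr0 I).le t)).trans h1
      refine (measureReal_unseen_le hp hq hq0.le hq1 η I n).trans ?_
      rw [wordProd_ite, mul_assoc 2 y, ← pow_succ', hy, ← Real.exp_nat_mul]
      refine mul_le_mul_of_nonneg_left (Real.exp_le_exp.mpr ?_) two_pos.le
      rw [mul_neg, neg_le_neg_iff]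
      calc ((k + 1 : ℕ) : ℝ) * (β * n) = c * (κ * δ ^ t * (ν * (k + 1))) * n := by
            rw [hβ, hB]
            push_cast
            ring
        _ ≤ _ := mul_le_mul_of_nonneg_right (mul_le_mul_of_nonneg_left hpI hc0.le)
            (Nat.cast_nonneg n)
    have ha : ∀ i, 0 ≤ if i = i₀ then 1 else y := fun i => by
      split_ifs
      · exact zero_le_one
      · exact hy0.le
    have ha1 : 1 ≤ ∑ i, if i = i₀ then 1 else y := by
      have := Finset.single_le_sum (f := fun i => if i = i₀ then 1 else y) (fun i _ => ha i)
        (Finset.mem_univ i₀)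
      simpa using this
    have ha2 : (∑ i, if i = i₀ then 1 else y) ≤ Real.exp (N * y) := by
      have h1 : (∑ i, if i = i₀ then 1 else y) ≤ ∑ i, ((if i = i₀ then 1 else 0) + y) := by
        refine Finset.sum_le_sum fun i _ => ?_
        split_ifs <;> linarith
      rw [Finset.sum_add_distrib, Finset.sum_ite_eq' Finset.univ i₀, if_pos (Finset.mem_univ _),
        Finset.sum_const, Finset.card_univ, Fintype.card_fin, nsmul_eq_mul] at h1
      linarith [Real.add_one_le_exp (N * y)]
    refine (measureReal_uncoveredCuts_le hp hlenL ha ha1 (by positivity) hunseen).trans ?_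
    have hexp : (L + 1) * y = Real.exp (-(β * (n - x))) := by
      have h1 : -(β * (n - x)) = Real.log (L + 1) + -(β * n) := by
        rw [hx]
        field_simp
        ring
      rw [h1, Real.exp_add, Real.exp_log (by linarith)]
    have hLy : (L + 1) * y ≤ 1 := by
      rw [hexp]
      exact Real.exp_le_one_iff.mpr (by nlinarith)
    have hpow : (∑ i, if i = i₀ then 1 else y) ^ L ≤ Real.exp N := by
      refine (pow_le_pow_left₀ (by linarith) ha2 L).trans ?_
      rw [← Real.exp_nat_mul, Real.exp_le_exp]
      have : (L : ℝ) * (N * y) ≤ N * ((L + 1) * y) := by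
        have : 0 ≤ (N : ℝ) * y := by positivity
        linarith
      exact this.trans (mul_le_of_le_one_right (Nat.cast_nonneg N) hLy)
    calc 2 * y * ((L + 1) * (∑ i, if i = i₀ then 1 else y) ^ L)
        = 2 * ((L + 1) * y) * (∑ i, if i = i₀ then 1 else y) ^ L := by ring
      _ ≤ 2 * ((L + 1) * y) * Real.exp N :=
          mul_le_mul_of_nonneg_left hpow (by positivity)
      _ = _ := by rw [hexp]; ring
  refine (expectedWaitingTime_le_of_tail hS hF hp hδ hv (by positivity) hβ0 hx0 htail).trans
    (ENNReal.ofReal_le_ofReal ?_)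
  have hβinv : 1 / β = T / B := by
    rw [hβ, hδT]
    field_simp
  have hlogL : Real.log (L + 1) ≤ (Real.log CL + 1) * m := by
    have h1 := Real.log_le_log (by linarith) hL
    rw [Real.log_mul (by linarith) hlpos.ne'] at h1
    have h2 : Real.log l ≤ m := le_max_right _ _
    nlinarith
  have e1 : x ≤ (Real.log CL + 1) / B * T * m := by
    have : x = Real.log (L + 1) * (T / B) := by rw [hx, div_eq_mul_one_div, hβinv]
    rw [this]
    calc Real.log (L + 1) * (T / B) ≤ (Real.log CL + 1) * m * (T / B) :=
          mul_le_mul_of_nonneg_right hlogL (by positivity)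
      _ = _ := by ring
  have hTm : 1 ≤ T * m := one_le_mul_of_one_le_of_one_le hT1 hm1
  have e2 : 1 + 2 * Real.exp N ≤ (1 + 2 * Real.exp N) * T * m := by
    rw [mul_assoc]
    exact le_mul_of_one_le_right (by positivity) hTm
  have e3 : 2 * Real.exp N * (1 / β) ≤ 2 * Real.exp N / B * T * m := by
    have : 2 * Real.exp N / B * T * m = 2 * Real.exp N * (T / B) * m := by ring
    rw [this, hβinv]
    exact le_mul_of_one_le_right (by positivity) hm1
  linarith

/-! ### The lower bounds -/

/-- Matthews' bound for the waiting time: the `δ`-density of the orbit forces all words of the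
family `A` to occur, as soon as their common ratio is large compared to `δ`. -/
lemma exists_le_expectedWaitingTime_of_family
    {S : Fin N → EuclideanSpace ℝ (Fin d) → EuclideanSpace ℝ (Fin d)} {r : Fin N → ℝ}
    (hN : 2 ≤ N) (hS : IsSimilitudeIFS S r) (hOSC : OpenSetCondition S)
    {F : Set (EuclideanSpace ℝ (Fin d))} (hF : IsAttractor S F) {p : Fin N → ℝ}
    (hp : IsNondegenerateProbVector p) :
    ∃ ρ : ℝ, 0 < ρ ∧ ∃ D : ℕ, ∀ (i j : Fin N), i ≠ j → ∀ (A : Finset (List (Fin N))) (m : ℕ)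
      (P R δ : ℝ), (∀ I ∈ A, List.replicate D i ++ [j] <+: I) → (∀ I ∈ A, I.length = m) →
      (∀ I ∈ A, wordProd p I = P) → (∀ I ∈ A, wordProd r I = R) → δ ≤ ρ * R → 7 ≤ A.card →
      ∀ v ∈ F, ENNReal.ofReal (1 / (32 * P) * Real.log (A.card + 1)) ≤
        expectedWaitingTime S F p δ v := by
  have hFS : ∀ i, ∀ x ∈ F, S i x ∈ F := fun i x hx => hF.map_mem i hx
  obtain ⟨q, hq0, hq1, hq⟩ := exists_upper_bound_lt_one (hp.lt_one hN)
  obtain ⟨K, hK⟩ := exists_separating_word hS hOSC hF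
  have hq' : 0 < 1 - q := by linarith
  obtain ⟨D, hD⟩ := exists_pow_lt_of_lt_one (by linarith : 0 < (1 - q) / 4) hq1
  have hD4 : q ^ D * (1 - q)⁻¹ ≤ 1 / 4 := by
    rw [← div_eq_mul_inv, div_le_iff₀ hq']
    linarith
  refine ⟨wordProd r K, wordProd_pos (fun i => (hS i).1) K, D,
    fun i j hij A m P R δ hmark hm hP hR hδ hcard v hv => ?_⟩
  obtain ⟨η, hη⟩ := exists_isCode hF.2.2.subset hv
  have hW : ∑' n, bernoulliMeasure p (uncovered η A n) ≤ expectedWaitingTime S F p δ v := by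
    calc ∑' n, bernoulliMeasure p (uncovered η A n)
        = ∫⁻ ω, ∑' n, (uncovered η A n).indicator 1 ω ∂(bernoulliMeasure p) := by
          rw [lintegral_tsum fun n => (measurable_one.indicator
            (isPast_uncovered η A (le_refl n)).measurableSet).aemeasurable]
          exact tsum_congr fun n => (lintegral_indicator_one
            (isPast_uncovered η A (le_refl n)).measurableSet).symm
      _ ≤ _ := lintegral_mono fun ω => by
          refine tsum_le_waitingTime (fun _ _ h => uncovered_antitone η A h) ?_
          rintro n - hdense ⟨I, hI, hu⟩
          obtain ⟨z, hz⟩ := hF.1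
          obtain ⟨_, ⟨k, hk, rfl⟩, hdist⟩ := hdense.2 (wordMap S (I ++ K) z)
            (wordMap_mem hFS _ hz)
          refine hu k hk.1 hk.2 (hK I _ _ _ (isCode_history hFS hη ω k) ⟨z, hz, rfl⟩ ?_)
          rw [wordProd_append, hR I hI, mul_comm]
          exact hdist.trans hδ
  refine le_trans ?_ hW
  obtain ⟨I, hI⟩ : A.Nonempty := Finset.card_pos.mp (by omega)
  have hP0 : 0 < P := hP I hI ▸ wordProd_pos hp.1 I
  have hP1 : P ≤ 1 / 4 := by
    have hlen : D ≤ I.length := by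
      have := (hmark I hI).length_le
      simp at this
      omega
    have h1 : P ≤ q ^ I.length := hP I hI ▸ wordProd_le_pow hp.1 hq I
    have h2 : q ^ I.length ≤ q ^ D := pow_le_pow_of_le_one hq0.le hq1.le hlen
    linarith
  set τ := ⌊1 / (4 * P)⌋₊ with hτ
  have hx1 : 1 ≤ 1 / (4 * P) := by
    rw [le_div_iff₀ (by positivity)]
    linarith
  have hτ1 : (τ : ℝ) ≤ 1 / (4 * P) := Nat.floor_le (by positivity)
  have hτ2 : 1 / (8 * P) ≤ τ := by
    have h1 : 1 ≤ τ := Nat.le_floor (by simpa using hx1)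
    have h2 : (1 : ℝ) ≤ τ := by exact_mod_cast h1
    have h3 : 1 / (4 * P) < τ + 1 := Nat.lt_floor_add_one _
    have h4 : 1 / (4 * P) = 2 * (1 / (8 * P)) := by field_simp; norm_num
    rw [h4] at h3
    linarith
  have h := ofReal_harmonic_le_tsum_uncovered hp hq hq0.le hq1 hij hD4 η (τ := τ) hmark hm
    fun J hJ => by
      rw [hP J hJ]
      calc τ * P ≤ 1 / (4 * P) * P := mul_le_mul_of_nonneg_right hτ1 hP0.le
        _ = 1 / 4 := by field_simp
  refine (ENNReal.ofReal_le_ofReal ?_).trans h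
  have hharm := log_add_one_le_harmonic A.card
  have hlog2 : 2 ≤ Real.log (A.card + 1) := by
    rw [Real.le_log_iff_exp_le (by positivity)]
    have h1 : Real.exp 2 = Real.exp 1 * Real.exp 1 := by rw [← Real.exp_add]; norm_num
    have h2 := Real.exp_one_lt_d9
    have h3 := Real.exp_pos 1
    have h4 : (7 : ℝ) ≤ A.card := by exact_mod_cast hcard
    nlinarith
  push_cast at hharm
  calc 1 / (32 * P) * Real.log (A.card + 1)
      = 1 / (8 * P) / 2 * (Real.log (A.card + 1) / 2) := by field_simp; norm_num
    _ ≤ τ / 2 * ((harmonic A.card : ℝ) - 1) := by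
        refine mul_le_mul (by linarith) (by linarith) (by linarith) (by positivity)

/-- Choice of the number of factors `g` that reaches the scale `δ`. -/
lemma exists_scale {ρ R₀ g t : ℝ} (hρ : 0 < ρ) (hR₀ : 0 < R₀) (hg0 : 0 < g) (hg1 : g < 1)
    (ht : 0 < t) : ∃ c₁ : ℝ, 0 < c₁ ∧ ∃ c₂ : ℝ, 0 < c₂ ∧ ∃ δ₀ : ℝ, 0 < δ₀ ∧ δ₀ < 1 ∧
      ∀ δ, 0 < δ → δ < δ₀ → ∃ k : ℕ, 7 ≤ k ∧ δ ≤ ρ * (R₀ * g ^ k) ∧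
        c₁ * δ ^ (-t) ≤ (R₀ * g ^ k) ^ (-t) ∧ c₂ * Real.log (1 / δ) ≤ k := by
  set a := ρ * R₀ with ha
  have ha0 : 0 < a := by positivity
  set lg := -Real.log g with hlg
  have hlg0 : 0 < lg := neg_pos.mpr (Real.log_neg hg0 hg1)
  set l₁ := 2 * |Real.log a| + 16 * lg with hl₁
  have hl₁pos : 0 < l₁ := by positivity
  refine ⟨(ρ * g) ^ t, by positivity, 1 / (4 * lg), by positivity, Real.exp (-l₁),
    Real.exp_pos _, Real.exp_lt_one_iff.mpr (by linarith), fun δ hδ hδ₀ => ?_⟩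
  set l := Real.log (1 / δ) with hl
  have hll : Real.log δ = -l := by rw [hl, one_div, Real.log_inv, neg_neg]
  have hl1 : l₁ < l := by
    have := Real.log_lt_log hδ hδ₀
    rw [Real.log_exp, hll] at this
    linarith
  have habs := neg_abs_le (Real.log a)
  have habs' := abs_nonneg (Real.log a)
  have hδa : δ ≤ a := by
    rw [← Real.log_le_log_iff hδ ha0, hll]
    linarith
  obtain ⟨k, hk1, hk2⟩ := exists_nat_pow_near_of_lt_one (div_pos hδ ha0)
    ((div_le_one ha0).mpr hδa) hg0 hg1
  rw [lt_div_iff₀ ha0] at hk1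
  rw [div_le_iff₀ ha0] at hk2
  have hklog : l - |Real.log a| < (k + 1) * lg := by
    have := Real.log_lt_log (by positivity) hk1
    rw [Real.log_mul (by positivity) ha0.ne', Real.log_pow, hll] at this
    push_cast at this
    have e : (k + 1) * lg = -((k + 1) * Real.log g) := by rw [hlg]; ring
    linarith
  refine ⟨k, ?_, ?_, ?_, ?_⟩
  · have : (8 : ℝ) < k + 1 := lt_of_mul_lt_mul_right (by linarith : 8 * lg < (k + 1) * lg) hlg0.le
    have : (7 : ℝ) < k := by linarith
    exact_mod_cast this.le
  · rw [← mul_assoc, mul_comm]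
    exact hk2
  · rw [Real.rpow_neg hδ.le, Real.rpow_neg (by positivity), ← div_eq_mul_inv,
      div_le_iff₀ (by positivity), ← div_eq_inv_mul, le_div_iff₀ (by positivity),
      ← Real.mul_rpow (by positivity) (by positivity)]
    refine Real.rpow_le_rpow (by positivity) (le_trans (le_of_eq ?_) hk1.le) ht.le
    rw [ha]
    ring
  · rw [div_mul_eq_mul_div, one_mul, div_le_iff₀ (by positivity)]
    linarith

/-- A lower bound for small `δ` extends to all `δ < 1`, since the waiting time is at least `1`. -/
lemma exists_lower_bound_of_small {X : Type*} {V : Set X} {W : X → ℝ → ℝ≥0∞} {φ : ℝ → ℝ} {t : ℝ}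
    (ht : 0 < t) (hφ : ∀ δ, 0 < δ → δ < 1 → φ δ ≤ Real.log (1 / δ)) (hW : ∀ v δ, 1 ≤ W v δ)
    {c δ₀ : ℝ} (hc : 0 < c) (hδ₀ : 0 < δ₀) (hδ₁ : δ₀ < 1)
    (h : ∀ v ∈ V, ∀ δ, 0 < δ → δ < δ₀ → ENNReal.ofReal (c * δ ^ (-t) * φ δ) ≤ W v δ) :
    ∃ c' : ℝ, 0 < c' ∧ ∀ v ∈ V, ∀ δ, 0 < δ → δ < 1 →
      ENNReal.ofReal (c' * δ ^ (-t) * φ δ) ≤ W v δ := by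
  have hl0 : 0 < Real.log (1 / δ₀) := Real.log_pos (by rw [lt_div_iff₀ hδ₀, one_mul]; exact hδ₁)
  have hT0 : 0 < δ₀ ^ (-t) := Real.rpow_pos_of_pos hδ₀ _
  refine ⟨min c (1 / (δ₀ ^ (-t) * Real.log (1 / δ₀))), by positivity, fun v hv δ hδ hδ1 => ?_⟩
  rcases le_or_gt (φ δ) 0 with hφ0 | hφ0
  · rw [ENNReal.ofReal_of_nonpos]
    · exact zero_le
    · exact mul_nonpos_of_nonneg_of_nonpos (by positivity) hφ0
  rcases lt_or_ge δ δ₀ with hs | hs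
  · refine (ENNReal.ofReal_le_ofReal ?_).trans (h v hv δ hδ hs)
    gcongr
    exact min_le_left _ _
  · refine le_trans ?_ (hW v δ)
    rw [← ENNReal.ofReal_one]
    refine ENNReal.ofReal_le_ofReal ?_
    have h1 : δ ^ (-t) ≤ δ₀ ^ (-t) := Real.rpow_le_rpow_of_nonpos hδ₀ hs (by linarith)
    have h2 : φ δ ≤ Real.log (1 / δ₀) := (hφ δ hδ hδ1).trans
      (Real.log_le_log (by positivity) (one_div_le_one_div_of_le hδ₀ hs))
    calc min c (1 / (δ₀ ^ (-t) * Real.log (1 / δ₀))) * δ ^ (-t) * φ δ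
        ≤ 1 / (δ₀ ^ (-t) * Real.log (1 / δ₀)) * δ₀ ^ (-t) * Real.log (1 / δ₀) := by
          gcongr
          exact min_le_right _ _
      _ = 1 := by field_simp

/-- All concatenations of `k` blocks, each equal to `i j` or to `j i`. -/
def blockWords (i j : Fin N) : ℕ → Finset (List (Fin N))
  | 0 => {[]}
  | k + 1 => (blockWords i j k).image (fun I => i :: j :: I) ∪
      (blockWords i j k).image (fun I => j :: i :: I)

lemma card_blockWords {i j : Fin N} (hij : i ≠ j) (k : ℕ) : (blockWords i j k).card = 2 ^ k := by
  induction k with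
  | zero => simp [blockWords]
  | succ k ih =>
    rw [blockWords, Finset.card_union_of_disjoint, Finset.card_image_of_injective,
      Finset.card_image_of_injective, ih, pow_succ]
    · ring
    · exact fun I J h => by simpa using h
    · exact fun I J h => by simpa using h
    · rw [Finset.disjoint_left]
      intro I h1 h2
      obtain ⟨J, -, rfl⟩ := Finset.mem_image.mp h1
      obtain ⟨J', -, h⟩ := Finset.mem_image.mp h2
      exact hij (List.cons.inj h).1.symm

lemma wordProd_of_mem_blockWords (p : Fin N → ℝ) {i j : Fin N} {k : ℕ} {I : List (Fin N)}
    (hI : I ∈ blockWords i j k) : wordProd p I = (p i * p j) ^ k := by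
  induction k generalizing I with
  | zero =>
    rw [Finset.mem_singleton.mp hI]
    simp
  | succ k ih =>
    rcases Finset.mem_union.mp hI with h | h <;>
    · obtain ⟨J, hJ, rfl⟩ := Finset.mem_image.mp h
      rw [wordProd_cons, wordProd_cons, ih hJ]
      ring

lemma length_of_mem_blockWords {i j : Fin N} {k : ℕ} {I : List (Fin N)}
    (hI : I ∈ blockWords i j k) : I.length = 2 * k := by
  induction k generalizing I with
  | zero =>
    rw [Finset.mem_singleton.mp hI]
    simp
  | succ k ih =>
    rcases Finset.mem_union.mp hI with h | h <;>
    · obtain ⟨J, hJ, rfl⟩ := Finset.mem_image.mp h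
      simp only [List.length_cons, ih hJ]
      ring

/-- The lower bound `δ ^ (-t) log (1 / δ)` when two letters satisfy `p i = r i ^ t`: the words
composed of these two letters are all of the smallest order of probability. -/
lemma exists_log_le_expectedWaitingTime
    {S : Fin N → EuclideanSpace ℝ (Fin d) → EuclideanSpace ℝ (Fin d)} {r : Fin N → ℝ}
    (hN : 2 ≤ N) (hS : IsSimilitudeIFS S r) (hOSC : OpenSetCondition S)
    {F : Set (EuclideanSpace ℝ (Fin d))} (hF : IsAttractor S F) {p : Fin N → ℝ}
    (hp : IsNondegenerateProbVector p) {t : ℝ} (ht : 0 < t) {i j : Fin N} (hij : i ≠ j)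
    (hi : p i = r i ^ t) (hj : p j = r j ^ t) :
    ∃ c : ℝ, 0 < c ∧ ∀ v ∈ F, ∀ δ : ℝ, 0 < δ → δ < 1 →
      ENNReal.ofReal (c * δ ^ (-t) * Real.log (1 / δ)) ≤ expectedWaitingTime S F p δ v := by
  have hr0 : ∀ i, 0 < r i := fun i => (hS i).1
  obtain ⟨ρ, hρ, D, hfam⟩ := exists_le_expectedWaitingTime_of_family hN hS hOSC hF hp
  set mk := List.replicate D i ++ [j] with hmk
  have hi0 := hr0 i
  have hj0 := hr0 j
  have hR₀ := wordProd_pos hr0 mk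
  have hg1 : r i * r j < 1 := mul_lt_one_of_nonneg_of_lt_one_left hi0.le (hS i).2.1 (hS j).2.1.le
  obtain ⟨c₁, hc₁, c₂, hc₂, δ₀, hδ₀, hδ₁, hscale⟩ := exists_scale hρ hR₀ (mul_pos hi0 hj0) hg1 ht
  have hlog2 : 0 < Real.log 2 := Real.log_pos one_lt_two
  refine exists_lower_bound_of_small (W := fun v δ => expectedWaitingTime S F p δ v)
    (φ := fun δ => Real.log (1 / δ)) ht (fun _ _ _ => le_rfl)
    (fun v δ => one_le_expectedWaitingTime S F hp δ v)
    (by positivity : 0 < c₁ / 32 * (c₂ * Real.log 2)) hδ₀ hδ₁ fun v hv δ hδ hδδ => ?_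
  obtain ⟨k, hk7, hkδ, hk1, hk2⟩ := hscale δ hδ hδδ
  set R := wordProd r mk * (r i * r j) ^ k with hR
  have hR0 : 0 < R := by positivity
  have hprod : ∀ (f : Fin N → ℝ), ∀ I ∈ (blockWords i j k).image (mk ++ ·),
      wordProd f I = wordProd f mk * (f i * f j) ^ k := by
    intro f I hI
    obtain ⟨J, hJ, rfl⟩ := Finset.mem_image.mp hI
    rw [wordProd_append, wordProd_of_mem_blockWords f hJ]
  have hcard : ((blockWords i j k).image (mk ++ ·)).card = 2 ^ k := by
    rw [Finset.card_image_of_injective _ (List.append_right_injective mk), card_blockWords hij]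
  have hPR : wordProd p mk * (p i * p j) ^ k = R ^ t := by
    have h1 : wordProd p mk = wordProd r mk ^ t := by
      rw [← wordProd_rpow hr0]
      simp only [hmk, wordProd, List.map_append, List.map_replicate, List.map_singleton, hi, hj]
    rw [h1, hi, hj, ← Real.mul_rpow hi0.le hj0.le, ← Real.rpow_natCast, ← Real.rpow_mul
      (by positivity), mul_comm t, Real.rpow_mul (by positivity), Real.rpow_natCast,
      ← Real.mul_rpow hR₀.le (by positivity)]
  have h := hfam i j hij ((blockWords i j k).image (mk ++ ·)) (mk.length + 2 * k) (R ^ t) R δ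
    (fun I hI => by
      obtain ⟨J, -, rfl⟩ := Finset.mem_image.mp hI
      exact List.prefix_append mk J)
    (fun I hI => by
      obtain ⟨J, hJ, rfl⟩ := Finset.mem_image.mp hI
      rw [List.length_append, length_of_mem_blockWords hJ])
    (fun I hI => (hprod p I hI).trans hPR) (fun I hI => hprod r I hI) hkδ
    (by
      rw [hcard]
      exact hk7.trans Nat.lt_two_pow_self.le) v hv
  refine (ENNReal.ofReal_le_ofReal ?_).trans h
  rw [hcard]
  have hlog : k * Real.log 2 ≤ Real.log (((2 ^ k : ℕ) : ℝ) + 1) := by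
    rw [← Real.log_pow]
    refine Real.log_le_log (by positivity) ?_
    push_cast
    linarith
  have hRt : 1 / (32 * R ^ t) = R ^ (-t) / 32 := by
    rw [Real.rpow_neg hR0.le]
    field_simp
  rw [hRt]
  calc c₁ / 32 * (c₂ * Real.log 2) * δ ^ (-t) * Real.log (1 / δ)
      = c₁ * δ ^ (-t) / 32 * (c₂ * Real.log (1 / δ) * Real.log 2) := by ring
    _ ≤ R ^ (-t) / 32 * (k * Real.log 2) := by
        refine mul_le_mul (by linarith) (mul_le_mul_of_nonneg_right hk2 hlog2.le) ?_
          (by positivity)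
        have : 0 < Real.log (1 / δ) :=
          Real.log_pos (by rw [lt_div_iff₀ hδ, one_mul]; exact hδδ.trans hδ₁)
        positivity
    _ ≤ _ := mul_le_mul_of_nonneg_left hlog (by positivity)

lemma replicate_append_cons_inj {i j : Fin N} (hij : i ≠ j) {a a' : ℕ} {I I' : List (Fin N)}
    (h : List.replicate a i ++ j :: I = List.replicate a' i ++ j :: I') : a = a' := by
  induction a generalizing a' with
  | zero =>
    cases a' with
    | zero => rfl
    | succ a' => exact absurd (List.cons.inj h).1.symm hij
  | succ a ih =>
    cases a' with
    | zero => exact absurd (List.cons.inj h).1 hij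
    | succ a' => rw [ih (List.cons.inj h).2]

/-- The lower bound `δ ^ (-t) log log (1 / δ)`: if `p i = r i ^ t`, then the `k + 1` words
`i ⋯ i j i ⋯ i` with `k` letters `i` after the initial marker are all of the smallest order of
probability. -/
lemma exists_log_log_le_expectedWaitingTime
    {S : Fin N → EuclideanSpace ℝ (Fin d) → EuclideanSpace ℝ (Fin d)} {r : Fin N → ℝ}
    (hN : 2 ≤ N) (hS : IsSimilitudeIFS S r) (hOSC : OpenSetCondition S)
    {F : Set (EuclideanSpace ℝ (Fin d))} (hF : IsAttractor S F) {p : Fin N → ℝ}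
    (hp : IsNondegenerateProbVector p) {t : ℝ} (ht : 0 < t) {i j : Fin N} (hij : i ≠ j)
    (hi : p i = r i ^ t) :
    ∃ c : ℝ, 0 < c ∧ ∀ v ∈ F, ∀ δ : ℝ, 0 < δ → δ < 1 →
      ENNReal.ofReal (c * δ ^ (-t) * Real.log (Real.log (1 / δ))) ≤
        expectedWaitingTime S F p δ v := by
  have hr0 : ∀ i, 0 < r i := fun i => (hS i).1
  obtain ⟨ρ, hρ, D, hfam⟩ := exists_le_expectedWaitingTime_of_family hN hS hOSC hF hp
  set mk := List.replicate D i ++ [j] with hmk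
  have hi0 := hr0 i
  have hj0 := hr0 j
  have hpj := hp.1 j
  have hmk0 := wordProd_pos hr0 mk
  have hR₀ : 0 < wordProd r mk * r j := by positivity
  obtain ⟨c₁, hc₁, c₂, hc₂, δ₀, hδ₀, hδ₁, hscale⟩ := exists_scale hρ hR₀ hi0 (hS i).2.1 ht
  set Q := (p j / r j ^ t) ^ 2 with hQ
  have hQ0 : 0 < Q := by positivity
  set e := min 1 c₂ with he
  have he0 : 0 < e := lt_min one_pos hc₂
  have hlpos : ∀ δ : ℝ, 0 < δ → δ < 1 → 0 < Real.log (1 / δ) := fun δ h0 h1 =>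
    Real.log_pos (by rw [lt_div_iff₀ h0, one_mul]; exact h1)
  refine exists_lower_bound_of_small (W := fun v δ => expectedWaitingTime S F p δ v)
    (φ := fun δ => Real.log (Real.log (1 / δ))) ht
    (fun δ h0 h1 => (Real.log_le_self (hlpos δ h0 h1).le))
    (fun v δ => one_le_expectedWaitingTime S F hp δ v)
    (by positivity : 0 < c₁ / (32 * Q) * e) hδ₀ hδ₁ fun v hv δ hδ hδδ => ?_
  have hl := hlpos δ hδ (hδδ.trans hδ₁)
  set l := Real.log (1 / δ) with hldef
  obtain ⟨k, hk7, hkδ, hk1, hk2⟩ := hscale δ hδ hδδ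
  set R := wordProd r mk * r j * r i ^ k with hR
  have hR0 : 0 < R := by positivity
  set word : ℕ → List (Fin N) := fun a =>
    mk ++ (List.replicate a i ++ j :: List.replicate (k - a) i) with hword
  set A := (Finset.range (k + 1)).image word with hA
  have hprod : ∀ (f : Fin N → ℝ), ∀ I ∈ A, wordProd f I = wordProd f mk * f j * f i ^ k := by
    intro f I hI
    obtain ⟨a, ha, rfl⟩ := Finset.mem_image.mp hI
    have hak : a + (k - a) = k := by
      have := Finset.mem_range.mp ha
      omega
    have hrep : ∀ n, wordProd f (List.replicate n i) = f i ^ n := fun n => by simp [wordProd]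
    have hpow : f i ^ k = f i ^ a * f i ^ (k - a) := by rw [← pow_add, hak]
    simp only [hword]
    rw [wordProd_append f mk, wordProd_append f (List.replicate a i), wordProd_cons, hrep, hrep,
      hpow]
    ring
  have hcard : A.card = k + 1 := by
    rw [hA, Finset.card_image_of_injective, Finset.card_range]
    exact fun a a' h => replicate_append_cons_inj hij (List.append_cancel_left h)
  have hPR : wordProd p mk * p j * p i ^ k = Q * R ^ t := by
    have h1 : ∀ f : Fin N → ℝ, wordProd f mk = f i ^ D * f j := fun f => by
      simp [hmk, wordProd]
    have h2 : ∀ n : ℕ, (r i ^ n) ^ t = (r i ^ t) ^ n := fun n => by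
      rw [← Real.rpow_natCast, ← Real.rpow_natCast, ← Real.rpow_mul hi0.le, ← Real.rpow_mul hi0.le,
        mul_comm]
    rw [hR, h1, h1, hi, Real.mul_rpow (by positivity) (by positivity),
      Real.mul_rpow (by positivity) hj0.le, Real.mul_rpow (by positivity) hj0.le, h2, h2, hQ]
    field_simp
  have h := hfam i j hij A (mk.length + (k + 1)) (Q * R ^ t) R δ
    (fun I hI => by
      obtain ⟨a, -, rfl⟩ := Finset.mem_image.mp hI
      exact List.prefix_append mk _)
    (fun I hI => by
      obtain ⟨a, ha, rfl⟩ := Finset.mem_image.mp hI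
      have := Finset.mem_range.mp ha
      simp only [hword, List.length_append, List.length_cons, List.length_replicate]
      omega)
    (fun I hI => (hprod p I hI).trans hPR) (fun I hI => hprod r I hI) hkδ
    (by omega) v hv
  refine (ENNReal.ofReal_le_ofReal ?_).trans h
  rw [hcard]
  -- `(1 + l) ^ e ≤ 1 + e l ≤ k + 2`
  have hlog : e * Real.log l ≤ Real.log (((k + 1 : ℕ) : ℝ) + 1) := by
    have h1 : (1 + l) ^ e ≤ 1 + e * l := rpow_one_add_le_one_add_mul_self (by linarith) he0.le
      (min_le_left _ _)
    have h2 : e * l ≤ k := (mul_le_mul_of_nonneg_right (min_le_right _ _) hl.le).trans hk2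
    calc e * Real.log l ≤ e * Real.log (1 + l) :=
          mul_le_mul_of_nonneg_left (Real.log_le_log hl (by linarith)) he0.le
      _ = Real.log ((1 + l) ^ e) := (Real.log_rpow (by linarith) e).symm
      _ ≤ _ := by
          refine Real.log_le_log (by positivity) ?_
          push_cast
          linarith
  have hlog0 : 0 ≤ Real.log (((k + 1 : ℕ) : ℝ) + 1) := Real.log_nonneg (by
    push_cast
    linarith [Nat.cast_nonneg (α := ℝ) k])
  have hRt : 1 / (32 * (Q * R ^ t)) = R ^ (-t) / (32 * Q) := by
    rw [Real.rpow_neg hR0.le]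
    field_simp
  rw [hRt]
  have hT : 0 < δ ^ (-t) := Real.rpow_pos_of_pos hδ _
  calc c₁ / (32 * Q) * e * δ ^ (-t) * Real.log l
      = c₁ * δ ^ (-t) / (32 * Q) * (e * Real.log l) := by ring
    _ ≤ c₁ * δ ^ (-t) / (32 * Q) * Real.log (((k + 1 : ℕ) : ℝ) + 1) :=
        mul_le_mul_of_nonneg_left hlog (by positivity)
    _ ≤ _ := mul_le_mul_of_nonneg_right
        (div_le_div_of_nonneg_right hk1 (by positivity)) hlog0

/-- The similarity dimension is at most the exponent, since `p i ≥ r i ^ t`; equality of the sums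
forces equality of the terms. -/
lemma similarityDimension_le_exponent {p r : Fin N → ℝ} (hN : 2 ≤ N)
    (hp : IsNondegenerateProbVector p) (hr0 : ∀ i, 0 < r i) (hr1 : ∀ i, r i < 1) {s : ℝ}
    (hs : IsSimilarityDimension r s) :
    s ≤ exponent p r ∧ (exponent p r = s ↔ ∀ i, p i = r i ^ s) := by
  have i₀ : Fin N := ⟨0, by omega⟩
  have hle := rpow_exponent_le hp.1 hr0 hr1
  refine ⟨?_, fun h => ?_, fun h => ?_⟩
  · by_contra hlt
    rw [not_le] at hlt
    have h1 : ∑ i, r i ^ s < ∑ i, r i ^ exponent p r :=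
      Finset.sum_lt_sum_of_nonempty ⟨i₀, Finset.mem_univ _⟩ fun i _ =>
        Real.rpow_lt_rpow_of_exponent_gt (hr0 i) (hr1 i) hlt
    have h2 := Finset.sum_le_sum fun i (_ : i ∈ Finset.univ) => hle i
    rw [hs.2] at h1
    rw [hp.2] at h2
    linarith
  · rw [h] at hle
    have heq := (Finset.sum_eq_sum_iff_of_le fun i (_ : i ∈ Finset.univ) => hle i).mp
      (hs.2.trans hp.2.symm)
    exact fun i => (heq i (Finset.mem_univ i)).symm
  · have : Nonempty (Fin N) := ⟨i₀⟩
    have hconst : ∀ i, Real.log (p i) / Real.log (r i) = s := fun i =>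
      (div_log_eq_iff (hp.1 i) (hr0 i) (hr1 i)).mpr (h i)
    simp only [exponent, hconst, ciSup_const]

end ChaosGame

theorem theorem1 {d N : ℕ} (hN : 2 ≤ N)
    (S : Fin N → EuclideanSpace ℝ (Fin d) → EuclideanSpace ℝ (Fin d)) (r : Fin N → ℝ)
    (hS : ChaosGame.IsSimilitudeIFS S r) (hOSC : ChaosGame.OpenSetCondition S)
    (F : Set (EuclideanSpace ℝ (Fin d))) (hF : ChaosGame.IsAttractor S F)
    (s : ℝ) (hs : ChaosGame.IsSimilarityDimension r s)
    (p : Fin N → ℝ) (hp : ChaosGame.IsNondegenerateProbVector p)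
    (t : ℝ) (ht : t = ChaosGame.exponent p r) :
    (s ≤ t ∧ (t = s ↔ ∀ i, p i = r i ^ s)) ∧
    ((∃! i, Real.log (p i) / Real.log (r i) = t) →
      ∃ C : ℝ, 0 < C ∧ ∀ v ∈ F, ∀ δ : ℝ, 0 < δ → (∀ i, δ < r i) →
        ENNReal.ofReal (C⁻¹ * δ ^ (-t) * Real.log (Real.log (1 / δ)))
            ≤ ChaosGame.expectedWaitingTime S F p δ v ∧
        ChaosGame.expectedWaitingTime S F p δ v
            ≤ ENNReal.ofReal (C * δ ^ (-t) * (max 1 (Real.log (Real.log (1 / δ)))) ^ 2)) ∧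
    ((¬ ∃! i, Real.log (p i) / Real.log (r i) = t) →
      ∃ C : ℝ, 0 < C ∧ ∀ v ∈ F, ∀ δ : ℝ, 0 < δ → (∀ i, δ < r i) →
        ENNReal.ofReal (C⁻¹ * δ ^ (-t) * Real.log (1 / δ))
            ≤ ChaosGame.expectedWaitingTime S F p δ v ∧
        ChaosGame.expectedWaitingTime S F p δ v
            ≤ ENNReal.ofReal (C * δ ^ (-t) * Real.log (1 / δ))) := by
  have hr0 : ∀ i, 0 < r i := fun i => (hS i).1
  have hr1 : ∀ i, r i < 1 := fun i => (hS i).2.1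
  have i₀ : Fin N := ⟨0, by omega⟩
  have ht0 : 0 < t := ht ▸ ChaosGame.exponent_pos hN hp hr0 hr1
  have hle : ∀ i, r i ^ t ≤ p i := fun i => ht ▸ ChaosGame.rpow_exponent_le hp.1 hr0 hr1 i
  have hiff : ∀ i, Real.log (p i) / Real.log (r i) = t ↔ p i = r i ^ t := fun i =>
    ChaosGame.div_log_eq_iff (hp.1 i) (hr0 i) (hr1 i)
  simp only [hiff]
  refine ⟨?_, fun huniq => ?_, fun hnot => ?_⟩
  · rw [ht]
    exact ChaosGame.similarityDimension_le_exponent hN hp hr0 hr1 hs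
  · obtain ⟨i, hi, huni⟩ := huniq
    have : Nontrivial (Fin N) := Fin.nontrivial_iff_two_le.mpr hN
    obtain ⟨j, hji⟩ := exists_ne i
    obtain ⟨c, hc, hlow⟩ := ChaosGame.exists_log_log_le_expectedWaitingTime hN hS hOSC hF hp ht0
      hji.symm hi
    obtain ⟨C, hC, hup⟩ := ChaosGame.exists_expectedWaitingTime_le_log_log hN hS hF hp ht0 (hle i)
      fun k hk => lt_of_le_of_ne (hle k) fun h => hk (huni k h.symm)
    refine ⟨max C c⁻¹, by positivity, fun v hv δ hδ hδr => ⟨?_, ?_⟩⟩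
    · have hδ1 : δ < 1 := (hδr i₀).trans (hr1 i₀)
      rcases le_or_gt (Real.log (Real.log (1 / δ))) 0 with h0 | h0
      · rw [ENNReal.ofReal_of_nonpos (mul_nonpos_of_nonneg_of_nonpos (by positivity) h0)]
        exact zero_le
      · refine (ENNReal.ofReal_le_ofReal ?_).trans (hlow v hv δ hδ hδ1)
        gcongr
        exact inv_le_of_inv_le₀ hc (le_max_right _ _)
    · refine (hup v hv δ hδ hδr).trans (ENNReal.ofReal_le_ofReal ?_)
      have hm : 1 ≤ max 1 (Real.log (Real.log (1 / δ))) := le_max_left _ _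
      gcongr
      · exact le_max_left _ _
      · exact le_self_pow₀ hm two_ne_zero
  · obtain ⟨i, hi⟩ : ∃ i, p i = r i ^ t := by
      have : Nonempty (Fin N) := ⟨i₀⟩
      obtain ⟨i, hi⟩ := exists_eq_ciSup_of_finite
        (f := fun i => Real.log (p i) / Real.log (r i))
      exact ⟨i, (hiff i).mp (hi.trans ht.symm)⟩
    obtain ⟨j, hj, hji⟩ : ∃ j, p j = r j ^ t ∧ j ≠ i := by
      by_contra hcon
      push Not at hcon
      exact hnot ⟨i, hi, hcon⟩
    obtain ⟨c, hc, hlow⟩ := ChaosGame.exists_log_le_expectedWaitingTime hN hS hOSC hF hp ht0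
      hji.symm hi hj
    obtain ⟨C, hC, hup⟩ := ChaosGame.exists_expectedWaitingTime_le_log hN hS hF hp ht0 hle
    refine ⟨max C c⁻¹, by positivity, fun v hv δ hδ hδr => ?_⟩
    have hδ1 : δ < 1 := (hδr i₀).trans (hr1 i₀)
    have hl : 0 < Real.log (1 / δ) := Real.log_pos (by rw [lt_div_iff₀ hδ, one_mul]; exact hδ1)
    refine ⟨(ENNReal.ofReal_le_ofReal ?_).trans (hlow v hv δ hδ hδ1),
      (hup v hv δ hδ hδr).trans (ENNReal.ofReal_le_ofReal ?_)⟩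
    · gcongr
      exact inv_le_of_inv_le₀ hc (le_max_right _ _)
    · gcongr
      exact le_max_left _ _
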